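/- Let $0<\beta<1$ and let $\chi:[1,\infty)\to(0,\infty)$ be continuous with $\chi(1)=1$, $\inf_{t\ge1}\chi(t)>0$, $\int_1^\infty\frac{dy}{\chi(y)\,y}<\infty$ and $\int_1^\infty\frac{y}{\chi(y)}\,dy<\infty$. Assume that there is $M>0$ such that for all $r\ge1$ $$\frac1{r^8}\Big(\int_1^r t^3\chi(t)\,dt\Big)\Big(\int_1^r\frac{t^3}{\chi(t)}\,dt\Big)\le M,\qquad \frac1{r^8}\int_1^r t^3\chi(t)\,dt\le M,\qquad \frac{\max_{[r,4r]}\chi}{\min_{[r,4r]}\chi}\le M,$$ and that there are constants $C_1,C_2>0$ such that for all integers $k\ge1$ $(D_1)$ $\displaystyle\int_1^\infty r^3\Big(\int_r^\infty\frac{dy}{\chi(y)\,y}\Big)^{\frac{k}{1-\beta}}dr<C_1^k$, $(D_2)$ $\displaystyle\int_1^\infty r^{3-\frac{2k}{1-\beta}}\Big(\int_1^r\frac{y}{\chi(y)}\,dy\Big)^{\frac{k}{1-\beta}}dr<C_2^k$. Put $\omega_\beta(x)=\big(\log\frac{e}{|x|}\big)^\beta$ for $|x|<1$ and $\omega_\beta(x)=\chi(|x|)$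 for $|x|\ge1$, $x\in\mathbb{R}^4$. Let $X_\beta$ be the space of radial functions $u\in L^{2/(1-\beta)}(\mathbb{R}^4)$ whose distributional Laplacian $\Delta u$ is a locally integrable function with $\int_{\mathbb{R}^4}\omega_\beta|\Delta u|^2\,dx<\infty$, with the norm $\|u\|_\beta=\big(\int_{\mathbb{R}^4}\omega_\beta|\Delta u|^2\,dx\big)^{1/2}$, and let $\alpha_\beta=4\,[8\pi^2(1-\beta)]^{\frac1{1-\beta}}$. **Theorem.** Let $(u_n)\subset X_\beta$ and $u\in X_\beta\setminus\{0\}$ be such that $\|u_n\|_\beta=1$ for all $n$ and $u_n\rightharpoonup u$ weakly in $X_\beta$ (that is, $\ell(u_n)\to\ell(u)$ for every linear functional $\ell$ on $X_\beta$ that is bounded with respect to $\|\cdot\|_\beta$). Then $$\sup_n\int_{\mathbb{R}^4}\Big(e^{p\,\alpha_\beta|u_n|^{\frac2{1-\beta}}}-1\Big)dx<\infty\qquad\text{for all } 0<p<P_\beta(u),$$ where $P_\beta(u)=(1-\|u\|_\beta^2)^{-\frac1{1-\beta}}$ if $\|u\|_\beta<1$ and $P_\beta(u)=+\infty$ if $\|u\|_\beta=1$.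 -/

import Mathlib

open MeasureTheory Set Filter Topology
open scoped ENNReal ContDiff Laplacian

noncomputable section

namespace WeightedAdams

/-- The Euclidean space `ℝ⁴`. -/
abbrev E4 : Type := EuclideanSpace ℝ (Fin 4)

/-- The radial weight: `(log (e / |x|)) ^ β` inside the unit ball, `χ (|x|)` outside. -/
def weight (β : ℝ) (χ : ℝ → ℝ) (x : E4) : ℝ :=
  if ‖x‖ < 1 then Real.log (Real.exp 1 / ‖x‖) ^ β else χ ‖x‖

/-- The standing assumptions on the profile `χ : [1, ∞) → (0, ∞)` of the weight
(the values of `χ` to the left of `1` are never used). -/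
structure ProfileAssumptions (χ : ℝ → ℝ) : Prop where
  pos : ∀ t, 1 ≤ t → 0 < χ t
  one : χ 1 = 1
  inf_pos : 0 < sInf (χ '' Ici 1)
  integrable_inv_mul_inv : IntegrableOn (fun y => (χ y)⁻¹ * y⁻¹) (Ici 1)
  integrable_inv_mul : IntegrableOn (fun y => (χ y)⁻¹ * y) (Ici 1)
  muckenhoupt : ∃ M : ℝ, 0 < M ∧
    (∀ r : ℝ, 1 ≤ r →
      1 / r ^ 8 * (∫ t in (1 : ℝ)..r, t ^ 3 * χ t) * (∫ t in (1 : ℝ)..r, t ^ 3 / χ t) ≤ M) ∧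
    (∀ r : ℝ, 1 ≤ r → 1 / r ^ 8 * (∫ t in (1 : ℝ)..r, t ^ 3 * χ t) ≤ M) ∧
    (∀ r : ℝ, 1 ≤ r → sSup (χ '' Icc r (4 * r)) / sInf (χ '' Icc r (4 * r)) ≤ M)

/-- `∫₁^∞ r³ (∫ᵣ^∞ dy / (χ(y) y)) ^ (k / (1 - β)) dr < C₁ᵏ` for all integers `k ≥ 1`. The
integrands are nonnegative, so the integrals are taken in `[0, ∞]`. -/
def ConditionD1 (β : ℝ) (χ : ℝ → ℝ) : Prop :=
  ∃ C₁ : ℝ, 0 < C₁ ∧ ∀ k : ℕ, 1 ≤ k →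
    ∫⁻ r in Ioi (1 : ℝ), ENNReal.ofReal (r ^ 3) *
      (∫⁻ y in Ioi r, ENNReal.ofReal (1 / (χ y * y))) ^ ((k : ℝ) / (1 - β))
        < ENNReal.ofReal (C₁ ^ k)

/-- `∫₁^∞ r^(3 - 2k/(1-β)) (∫₁^r y / χ(y) dy) ^ (k / (1 - β)) dr < C₂ᵏ` for all `k ≥ 1`. -/
def ConditionD2 (β : ℝ) (χ : ℝ → ℝ) : Prop :=
  ∃ C₂ : ℝ, 0 < C₂ ∧ ∀ k : ℕ, 1 ≤ k →
    ∫⁻ r in Ioi (1 : ℝ), ENNReal.ofReal (r ^ (3 - 2 * (k : ℝ) / (1 - β))) *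
      (∫⁻ y in Ioc 1 r, ENNReal.ofReal (y / χ y)) ^ ((k : ℝ) / (1 - β))
        < ENNReal.ofReal (C₂ ^ k)

/-- `f` is the Laplacian of `u` in the sense of distributions on `ℝ⁴`. -/
structure IsWeakLaplacian (u f : E4 → ℝ) : Prop where
  left : LocallyIntegrable u
  right : LocallyIntegrable f
  eq : ∀ φ : E4 → ℝ, ContDiff ℝ ∞ φ → HasCompactSupport φ →
    ∫ x, (Δ φ) x * u x = ∫ x, φ x * f x

open Classical in
/-- The weak Laplacian of `u`; it is determined up to null sets when it exists
(`IsWeakLaplacian.ae_eq`), and is `0` by convention otherwise. -/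
def weakLaplacian (u : E4 → ℝ) : E4 → ℝ :=
  if h : ∃ f, IsWeakLaplacian u f then h.choose else 0

theorem IsWeakLaplacian.ae_eq {u f g : E4 → ℝ} (hf : IsWeakLaplacian u f)
    (hg : IsWeakLaplacian u g) : f =ᵐ[volume] g := by
  refine ae_eq_of_integral_contDiff_smul_eq hf.right hg.right fun φ h1 h2 => ?_
  simpa only [smul_eq_mul] using (hf.eq φ h1 h2).symm.trans (hg.eq φ h1 h2)

theorem IsWeakLaplacian.weakLaplacian_ae_eq {u f : E4 → ℝ} (hf : IsWeakLaplacian u f) :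
    weakLaplacian u =ᵐ[volume] f := by
  have h : ∃ f, IsWeakLaplacian u f := ⟨f, hf⟩
  simp only [weakLaplacian, dif_pos h]
  exact h.choose_spec.ae_eq hf

theorem IsWeakLaplacian.congr {u v f : E4 → ℝ} (hf : IsWeakLaplacian u f)
    (h : u =ᵐ[volume] v) : IsWeakLaplacian v f where
  left := hf.left.congr h
  right := hf.right
  eq φ h1 h2 := by
    rw [← hf.eq φ h1 h2]
    refine integral_congr_ae ?_
    filter_upwards [h] with x hx
    rw [hx]

theorem continuous_laplacian {φ : E4 → ℝ} (h : ContDiff ℝ ∞ φ) (hc : HasCompactSupport φ) :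
    Continuous (Δ φ) := by
  have : (Δ φ) = fun x => (Δ (hc.toSchwartzMap h)) x := by
    funext x
    rw [SchwartzMap.laplacian_apply]
    rfl
  rw [this]
  exact SchwartzMap.continuous _

theorem hasCompactSupport_laplacian {φ : E4 → ℝ} (hc : HasCompactSupport φ) :
    HasCompactSupport (Δ φ) := by
  rw [InnerProductSpace.laplacian_eq_iteratedFDeriv_stdOrthonormalBasis]
  have h2 := hc.iteratedFDeriv (𝕜 := ℝ) 2
  refine h2.mono fun x hx => ?_
  rw [Function.mem_support] at hx ⊢
  intro h0
  apply hx
  simp [h0]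

theorem IsWeakLaplacian.add {u v f g : E4 → ℝ} (hf : IsWeakLaplacian u f)
    (hg : IsWeakLaplacian v g) : IsWeakLaplacian (u + v) (f + g) where
  left := hf.left.add hg.left
  right := hf.right.add hg.right
  eq φ h1 h2 := by
    have hL := continuous_laplacian h1 h2
    have hS := hasCompactSupport_laplacian h2
    have i1 := hf.left.integrable_smul_left_of_hasCompactSupport hL hS
    have i2 := hg.left.integrable_smul_left_of_hasCompactSupport hL hS
    have i3 := hf.right.integrable_smul_left_of_hasCompactSupport h1.continuous h2
    have i4 := hg.right.integrable_smul_left_of_hasCompactSupport h1.continuous h2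
    simp only [smul_eq_mul] at i1 i2 i3 i4
    simp only [Pi.add_apply, mul_add]
    rw [integral_add i1 i2, integral_add i3 i4, hf.eq φ h1 h2, hg.eq φ h1 h2]

theorem IsWeakLaplacian.smul {u f : E4 → ℝ} (c : ℝ) (hf : IsWeakLaplacian u f) :
    IsWeakLaplacian (c • u) (c • f) where
  left := hf.left.smul c
  right := hf.right.smul c
  eq φ h1 h2 := by
    simp only [Pi.smul_apply, smul_eq_mul, mul_left_comm _ c]
    rw [integral_const_mul, integral_const_mul, hf.eq φ h1 h2]

theorem isWeakLaplacian_zero : IsWeakLaplacian 0 0 where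
  left := locallyIntegrable_zero
  right := locallyIntegrable_zero
  eq φ _ _ := by simp

theorem measurable_weight (β : ℝ) {χ : ℝ → ℝ} (hχ : ContinuousOn χ (Ici 1)) :
    Measurable (weight β χ) := by
  have h1 : Measurable (fun x : E4 => if ‖x‖ < 1 then (0 : ℝ) else χ (max 1 ‖x‖)) := by
    refine Measurable.ite (measurableSet_lt measurable_norm measurable_const)
      measurable_const (Continuous.measurable ?_)
    exact hχ.comp_continuous (continuous_const.max continuous_norm) fun x => mem_Ici.2 (le_max_left _ _)
  have h2 : Measurable (fun x : E4 => if ‖x‖ < 1 then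
      Real.log (Real.exp 1 / ‖x‖) ^ β else (0 : ℝ)) := by
    refine Measurable.ite (measurableSet_lt measurable_norm measurable_const) ?_
      measurable_const
    exact (Real.measurable_log.comp (measurable_const.div measurable_norm)).pow_const β
  convert h1.add h2 using 1
  funext x
  by_cases hx : ‖x‖ < 1
  · simp [weight, hx]
  · simp [weight, hx, max_eq_right (not_lt.mp hx)]

/-- The space `X_β` of (classes of) radial functions `u ∈ L^{2/(1-β)}(ℝ⁴)` whose weak Laplacian
exists and satisfies `∫ ω_β |Δu|² dx < ∞`. -/
def X (β : ℝ) (χ : ℝ → ℝ) (hχ : ContinuousOn χ (Ici 1)) :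
    Submodule ℝ (Lp ℝ (ENNReal.ofReal (2 / (1 - β))) (volume : Measure E4)) where
  carrier := {u | (∃ g : ℝ → ℝ, Measurable g ∧ u =ᵐ[volume] fun x : E4 => g ‖x‖) ∧
    ∃ f : E4 → ℝ, IsWeakLaplacian u f ∧ Integrable (fun x => weight β χ x * f x ^ 2)}
  zero_mem' := by
    refine ⟨⟨0, measurable_const, ?_⟩, 0, isWeakLaplacian_zero.congr ?_, by simp⟩
    · exact Lp.coeFn_zero _ _ _
    · exact (Lp.coeFn_zero _ _ _).symm
  add_mem' := by
    rintro u v ⟨⟨g₁, hg₁, hu⟩, f₁, hf₁, i₁⟩ ⟨⟨g₂, hg₂, hv⟩, f₂, hf₂, i₂⟩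
    refine ⟨⟨g₁ + g₂, hg₁.add hg₂, ?_⟩, f₁ + f₂,
      (hf₁.add hf₂).congr (Lp.coeFn_add u v).symm, ?_⟩
    · filter_upwards [Lp.coeFn_add u v, hu, hv] with x h h1 h2
      exact h.trans (by simp [h1, h2])
    · refine ((i₁.norm.const_mul 2).add (i₂.norm.const_mul 2)).mono ?_ ?_
      · exact (measurable_weight β hχ).aestronglyMeasurable.mul
          ((hf₁.right.add hf₂.right).aestronglyMeasurable.pow 2)
      · refine Eventually.of_forall fun x => ?_
        simp only [Pi.add_apply, norm_mul, norm_pow, Real.norm_eq_abs, sq_abs]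
        refine le_trans ?_ (le_abs_self _)
        nlinarith [mul_nonneg (abs_nonneg (weight β χ x)) (sq_nonneg (f₁ x - f₂ x))]
  smul_mem' := by
    rintro c u ⟨⟨g, hg, hu⟩, f, hf, i⟩
    refine ⟨⟨c • g, hg.const_smul c, ?_⟩, c • f,
      (hf.smul c).congr (Lp.coeFn_smul c u).symm, ?_⟩
    · filter_upwards [Lp.coeFn_smul c u, hu] with x h h1
      simp [h, h1]
    · convert i.const_mul (c ^ 2) using 1
      funext x
      simp only [Pi.smul_apply, smul_eq_mul]
      ring

/-- The norm `‖u‖_β = (∫ ω_β |Δu|² dx)^{1/2}` of `X_β`. -/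
def betaNorm {β : ℝ} {χ : ℝ → ℝ} {hχ : ContinuousOn χ (Ici 1)} (u : X β χ hχ) : ℝ :=
  √(∫ x, weight β χ x * weakLaplacian u.1 x ^ 2)

/-- Weak convergence in `(X_β, ‖·‖_β)`: convergence against every linear functional that is
bounded for `‖·‖_β`. -/
def WeaklyConverges {β : ℝ} {χ : ℝ → ℝ} {hχ : ContinuousOn χ (Ici 1)}
    (u : ℕ → X β χ hχ) (v : X β χ hχ) : Prop :=
  ∀ l : X β χ hχ →ₗ[ℝ] ℝ, (∃ C : ℝ, ∀ w, |l w| ≤ C * betaNorm w) →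
    Tendsto (fun n => l (u n)) atTop (𝓝 (l v))

/-- `α_β = 4 [8 π² (1 - β)]^{1/(1-β)}`. -/
def alphaBeta (β : ℝ) : ℝ :=
  4 * (8 * Real.pi ^ 2 * (1 - β)) ^ (1 / (1 - β))

/-- `P_β(u) = (1 - ‖u‖_β²)^{-1/(1-β)}` if `‖u‖_β < 1`, and `+∞` if `‖u‖_β = 1`. -/
def threshold {β : ℝ} {χ : ℝ → ℝ} {hχ : ContinuousOn χ (Ici 1)} (u : X β χ hχ) : ℝ≥0∞ :=
  if betaNorm u < 1 then
    ENNReal.ofReal (1 / (1 - betaNorm u ^ 2) ^ (1 / (1 - β)))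
  else ⊤

end WeightedAdams

end

noncomputable section

namespace WeightedAdams

/-! A radial `u` in the space is recovered from `f = Δu`: averaging the Newtonian kernel over
spheres gives `4π² u(x) = -∫ f(y) max(|x|,|y|)⁻² dy` (`ae_eq_radialPotential`). Cauchy–Schwarz
against the weight then yields `4π² |u(x)| ≤ ‖u‖_β √S(|x|)`, where `S` is `kernelEnergy`. Near the
origin `S(r)` is at most `2π² (1 - log r)^(1-β) / (1-β)` plus a constant, and `alphaBeta` is
normalised so that a bound `4π² |w| ≤ η √S + C` makes `exp(p α_β |w|^q)`, with `q = 2/(1-β)`, at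
most a constant times `|x|^(-4θ)`, for any `θ > p η^q`. In dimension four this is integrable once `θ
< 1`. Outside the unit ball the integrand is controlled by `S^(1/(1-β))`, integrable by
`ConditionD1` and `ConditionD2`. This is `exists_lintegral_exp_le`.

The improvement over `p < 1` comes from two facts. Weak convergence in an inner product space gives
`‖u_n - u₀‖_β² → 1 - ‖u₀‖_β²` (`tendsto_betaNorm_sub`). A fixed function is negligible at the
critical scale: `4π² |u₀| ≤ ε √S + C_ε` for every `ε > 0`, because small balls carry little energy
(`exists_abs_radialPotential_le`). So for large `n` the bound holds with `η` as close as desired to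
`√(1 - ‖u₀‖_β²)`, and `p < P_β(u₀)` says exactly that `p η^q < 1` is attainable. The strict
inequality absorbs every additive constant, so no critical inequality is needed. -/

/-! ### Polar coordinates on `ℝ⁴` -/

theorem volume_ball_E4 : (volume : Measure E4) (Metric.ball 0 1) = ENNReal.ofReal (Real.pi ^ 2 / 2) := by
  rw [InnerProductSpace.volume_ball_of_dim_even (k := 2) (by simp)]
  simp [Nat.factorial]

/-- Integration of a radial function on `ℝ⁴` in polar coordinates. -/
theorem lintegral_radial {G : ℝ → ℝ≥0∞} (hG : Measurable G) :
    ∫⁻ x : E4, G ‖x‖ =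
      ENNReal.ofReal (2 * Real.pi ^ 2) * ∫⁻ r in Ioi (0 : ℝ), ENNReal.ofReal (r ^ 3) * G r := by
  calc
    ∫⁻ x : E4, G ‖x‖ = ∫⁻ x : ({(0)}ᶜ : Set E4), G (‖x.1‖) ∂((volume : Measure E4).comap (↑)) := by
      rw [lintegral_subtype_comap (measurableSet_singleton _).compl fun x : E4 ↦ G (‖x‖),
        restrict_compl_singleton]
    _ = ∫⁻ x, G x.2 ∂((volume : Measure E4).toSphere.prod (.volumeIoiPow (Module.finrank ℝ E4 - 1))) := by
      rw [← ((volume : Measure E4).measurePreserving_homeomorphUnitSphereProd).lintegral_comp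
        (f := fun x => G x.2) (by fun_prop)]
      simp
    _ = (∫⁻ x : Ioi (0 : ℝ), G x ∂.volumeIoiPow (Module.finrank ℝ E4 - 1)) *
        (volume : Measure E4).toSphere univ := by
      rw [lintegral_prod_symm _ (by fun_prop)]
      simp only [lintegral_const]
      rw [lintegral_mul_const _ (by fun_prop)]
    _ = _ := by
      rw [Measure.toSphere_apply_univ, volume_ball_E4, mul_comm]
      congr 1
      · rw [finrank_euclideanSpace_fin, ← ENNReal.ofReal_natCast, ← ENNReal.ofReal_mul (by positivity)]
        congr 1
        push_cast
        ring
      · rw [Measure.volumeIoiPow, lintegral_withDensity_eq_lintegral_mul _ (by fun_prop) (by fun_prop)]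
        rw [← lintegral_subtype_comap measurableSet_Ioi]
        simp

theorem integral_radial (G : ℝ → ℝ) :
    ∫ x : E4, G ‖x‖ = 2 * Real.pi ^ 2 * ∫ r in Ioi (0 : ℝ), r ^ 3 * G r := by
  rw [integral_fun_norm_addHaar, measureReal_def, volume_ball_E4, ENNReal.toReal_ofReal (by positivity)]
  simp
  ring

/-- Polar integration of the indicator of a measurable null set of radii gives zero. This transfers
identities between radial profiles, known for almost every radius, to `ℝ⁴`. -/
theorem ae_norm_of_ae {P : ℝ → Prop} (h : ∀ᵐ r : ℝ, 0 < r → P r) : ∀ᵐ x : E4, P ‖x‖ := by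
  obtain ⟨N, hN, hNm, hN0⟩ := exists_measurable_superset_of_null (ae_iff.1 h)
  have h1 : ∫⁻ x : E4, N.indicator 1 ‖x‖ = 0 := by
    rw [lintegral_radial (measurable_one.indicator hNm)]
    have : ∫⁻ r in Ioi (0 : ℝ), ENNReal.ofReal (r ^ 3) * N.indicator 1 r = 0 := by
      refine (lintegral_congr_ae (ae_restrict_of_ae ?_)).trans lintegral_zero
      filter_upwards [measure_eq_zero_iff_ae_notMem.1 hN0] with r hr
      simp [hr]
    rw [this, mul_zero]
  replace h1 := (lintegral_eq_zero_iff ((measurable_one.indicator hNm).comp measurable_norm)).1 h1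
  have h0 : ∀ᵐ x : E4, x ≠ 0 := by simp [ae_iff]
  filter_upwards [h1, h0] with x hx hx0
  by_contra hP
  have : ‖x‖ ∈ N := hN (by simpa using ⟨hx0, hP⟩)
  simp [this] at hx

/-! ### Radial Laplacians, du Bois-Reymond's lemma and radial test functions -/

/-- Using `‖x‖ ^ 2` as the variable keeps radial functions smooth at the origin; the coefficient `8`
is twice the dimension. -/
theorem laplacian_comp_norm_sq {F : ℝ → ℝ} (hF : ContDiff ℝ ∞ F) (x : E4) :
    (Δ (fun x : E4 => F (‖x‖ ^ 2))) x =
      4 * ‖x‖ ^ 2 * deriv (deriv F) (‖x‖ ^ 2) + 8 * deriv F (‖x‖ ^ 2) := by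
  obtain ⟨hd, hF1⟩ := contDiff_infty_iff_deriv.1 hF
  obtain ⟨hd1, -⟩ := contDiff_infty_iff_deriv.1 hF1
  have hn : ∀ y : E4, HasFDerivAt (fun x : E4 => ‖x‖ ^ 2) ((2 : ℝ) • innerSL ℝ y) y := fun y => by
    have := (hasStrictFDerivAt_norm_sq y).hasFDerivAt
    rwa [← Nat.cast_smul_eq_nsmul ℝ] at this
  obtain ⟨I, hI⟩ : ∃ I : E4 →L[ℝ] E4 →L[ℝ] ℝ, ∀ y, I y = innerSL ℝ y := ⟨innerSL ℝ, fun _ => rfl⟩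
  simp only [← hI] at hn
  have h1 : ∀ y : E4, HasFDerivAt (fun x : E4 => F (‖x‖ ^ 2))
      (deriv F (‖y‖ ^ 2) • ((2 : ℝ) • I y)) y := fun y =>
    (hd _).hasDerivAt.comp_hasFDerivAt y (hn y)
  have h2 : fderiv ℝ (fun x : E4 => F (‖x‖ ^ 2)) =
      fun y => deriv F (‖y‖ ^ 2) • ((2 : ℝ) • I y) := by
    funext y; exact (h1 y).fderiv
  have h3 : HasFDerivAt (fun y : E4 => deriv F (‖y‖ ^ 2) • ((2 : ℝ) • I y))
      (deriv F (‖x‖ ^ 2) • ((2 : ℝ) • I) +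
        (deriv (deriv F) (‖x‖ ^ 2) • ((2 : ℝ) • I x)).smulRight
          ((2 : ℝ) • I x)) x :=
    ((hd1 _).hasDerivAt.comp_hasFDerivAt x (hn x)).smul
      ((I.hasFDerivAt).const_smul (2 : ℝ))
  rw [InnerProductSpace.laplacian_eq_iteratedFDeriv_orthonormalBasis _
    (EuclideanSpace.basisFun (Fin 4) ℝ)]
  simp only [iteratedFDeriv_two_apply, h2, h3.fderiv]
  have h4 : ‖x‖ ^ 2 = x 0 ^ 2 + x 1 ^ 2 + x 2 ^ 2 + x 3 ^ 2 := by
    rw [EuclideanSpace.norm_sq_eq]; simp [Fin.sum_univ_four]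
  simp [Fin.sum_univ_four, hI]
  simp only [EuclideanSpace.inner_single_right, one_mul]
  simp
  generalize deriv (deriv F) (‖x‖ ^ 2) = A
  generalize deriv F (‖x‖ ^ 2) = B
  rw [h4]
  ring

theorem hasDerivAt_primitive {k : ℝ → ℝ} (hk : Continuous k) (a s : ℝ) :
    HasDerivAt (fun s => ∫ t in a..s, k t) (k s) s :=
  intervalIntegral.integral_hasDerivAt_right (hk.intervalIntegrable _ _)
    hk.stronglyMeasurable.stronglyMeasurableAtFilter hk.continuousAt

theorem contDiff_primitive {k : ℝ → ℝ} (hk : ContDiff ℝ ∞ k) (a : ℝ) :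
    ContDiff ℝ ∞ (fun s => ∫ t in a..s, k t) := by
  rw [contDiff_infty_iff_deriv]
  refine ⟨fun s => (hasDerivAt_primitive hk.continuous a s).differentiableAt, ?_⟩
  have : deriv (fun s => ∫ t in a..s, k t) = k :=
    funext fun s => (hasDerivAt_primitive hk.continuous a s).deriv
  rwa [this]

theorem exists_Ioo_of_tsupport {ψ : ℝ → ℝ} (hc : HasCompactSupport ψ) (hs : tsupport ψ ⊆ Ioi 0) :
    ∃ a b : ℝ, 0 < a ∧ a < b ∧ tsupport ψ ⊆ Ioo a b := by
  rcases (tsupport ψ).eq_empty_or_nonempty with h | h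
  · exact ⟨1, 2, by norm_num, by norm_num, by simp [h]⟩
  · obtain ⟨m, hm, hm'⟩ := hc.isCompact.exists_isLeast h
    obtain ⟨M, hM, hM'⟩ := hc.isCompact.exists_isGreatest h
    have h0 : 0 < m := hs hm
    have h1 : m ≤ M := hm' hM
    exact ⟨m / 2, M + 1, by linarith, by linarith, fun x hx =>
      ⟨by linarith [hm' hx], by linarith [hM' hx]⟩⟩

theorem integrable_mul_of_locallyIntegrableOn {w h : ℝ → ℝ} {U : Set ℝ}
    (hw : LocallyIntegrableOn w U) (hh : Continuous h) (hc : HasCompactSupport h)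
    (hs : tsupport h ⊆ U) : Integrable (fun r => h r * w r) := by
  have h1 : IntegrableOn w (tsupport h) := hw.integrableOn_compact_subset hs hc.isCompact
  have h2 : IntegrableOn (fun r => h r * w r) (tsupport h) :=
    h1.continuousOn_mul hh.continuousOn hc.isCompact
  rwa [integrableOn_iff_integrable_of_support_subset] at h2
  intro x hx
  refine subset_tsupport _ ?_
  rw [Function.mem_support] at hx ⊢
  exact left_ne_zero_of_mul hx

/-- The lemma of du Bois-Reymond on the half-line. -/
theorem ae_eq_const_of_integral_deriv_mul_eq_zero {w : ℝ → ℝ}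
    (hw : LocallyIntegrableOn w (Ioi 0))
    (h : ∀ ψ : ℝ → ℝ, ContDiff ℝ ∞ ψ → HasCompactSupport ψ → tsupport ψ ⊆ Ioi 0 →
      ∫ r, deriv ψ r * w r = 0) :
    ∃ c, ∀ᵐ r : ℝ, 0 < r → w r = c := by
  -- A fixed bump of mass one supported in `[1, 3]`; the constant will be the mean of `w` against
  -- it.
  let B : ContDiffBump (2 : ℝ) := ⟨1 / 2, 1, by norm_num, by norm_num⟩
  set h₀ : ℝ → ℝ := B.normed volume with hh₀
  have h₀d : ContDiff ℝ ∞ h₀ := B.contDiff_normed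
  have h₀c : HasCompactSupport h₀ := B.hasCompactSupport_normed
  have h₀s : tsupport h₀ ⊆ Ioi 0 := by
    rw [hh₀, B.tsupport_normed_eq]
    intro x hx
    rw [Real.closedBall_eq_Icc] at hx
    have : (2 : ℝ) - 1 ≤ x := hx.1
    exact lt_of_lt_of_le (by norm_num) this
  have h₀1 : ∫ x, h₀ x = 1 := B.integral_normed
  refine ⟨∫ r, h₀ r * w r, ?_⟩
  have key := isOpen_Ioi.ae_eq_zero_of_integral_contDiff_smul_eq_zero (μ := volume)
    (f := fun r => w r - ∫ r, h₀ r * w r) (U := Ioi (0 : ℝ))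
    (hw.sub ((locallyIntegrable_const (∫ r, h₀ r * w r)).locallyIntegrableOn _)) ?_
  · filter_upwards [key] with r hr hr0
    linarith [hr hr0]
  intro g hg hgc hgs
  -- Subtracting the mass of `g` makes the integral of `k` vanish, so its primitive has compact
  -- support in the half-line and is an admissible `ψ` with `ψ' = k`.
  set k : ℝ → ℝ := fun r => g r - (∫ x, g x) * h₀ r with hk
  have hkd : ContDiff ℝ ∞ k := hg.sub (contDiff_const.mul h₀d)
  obtain ⟨a, b, ha, hab, habs⟩ := exists_Ioo_of_tsupport hgc hgs
  obtain ⟨a', b', ha', hab', habs'⟩ := exists_Ioo_of_tsupport h₀c h₀s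
  have gi : Integrable g := hg.continuous.integrable_of_hasCompactSupport hgc
  have h₀i : Integrable h₀ := h₀d.continuous.integrable_of_hasCompactSupport h₀c
  have hk0 : ∀ r, r ∉ Ioo (min a a') (max b b') → k r = 0 := by
    intro r hr
    have e1 : g r = 0 := by
      by_contra hne
      have := habs (subset_tsupport _ hne)
      exact hr ⟨(min_le_left _ _).trans_lt this.1, this.2.trans_le (le_max_left _ _)⟩
    have e2 : h₀ r = 0 := by
      by_contra hne
      have := habs' (subset_tsupport _ hne)
      exact hr ⟨(min_le_right _ _).trans_lt this.1, this.2.trans_le (le_max_right _ _)⟩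
    simp [hk, e1, e2]
  have hkint : ∫ r, k r = 0 := by
    simp only [hk]
    rw [integral_sub gi (h₀i.const_mul _), integral_const_mul, h₀1]
    ring
  have hA : 0 < min a a' := lt_min ha ha'
  have hψsupp : Function.support (fun s => ∫ t in (min a a')..s, k t) ⊆
      Icc (min a a') (max b b') := by
    intro s hs
    by_contra hns
    apply hs
    rcases lt_or_ge s (min a a') with h1 | h1
    · change (∫ t in (min a a')..s, k t) = 0
      rw [intervalIntegral.integral_of_ge h1.le, setIntegral_eq_zero_of_forall_eq_zero, neg_zero]
      intro t ht
      exact hk0 t fun h => absurd h.1 (not_lt.2 ht.2)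
    · have h2 : max b b' < s := lt_of_not_ge fun h => hns ⟨h1, h⟩
      change (∫ t in (min a a')..s, k t) = 0
      rw [intervalIntegral.integral_of_le h1, ← hkint]
      refine setIntegral_eq_integral_of_forall_compl_eq_zero fun t ht => hk0 t fun h => ht ?_
      exact ⟨h.1, h.2.le.trans h2.le⟩
  have hψt : tsupport (fun s => ∫ t in (min a a')..s, k t) ⊆ Icc (min a a') (max b b') :=
    closure_minimal hψsupp isClosed_Icc
  have := h _ (contDiff_primitive hkd (min a a'))
    (HasCompactSupport.of_support_subset_isCompact isCompact_Icc hψsupp)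
    (hψt.trans fun x hx => hA.trans_le hx.1)
  simp only [(hasDerivAt_primitive hkd.continuous _ _).deriv] at this
  have i1 := integrable_mul_of_locallyIntegrableOn hw hg.continuous hgc hgs
  have i2 := integrable_mul_of_locallyIntegrableOn hw h₀d.continuous h₀c h₀s
  simp only [smul_eq_mul, mul_sub]
  rw [integral_sub i1 (gi.mul_const _), integral_mul_const, ← this]
  simp only [hk, sub_mul, mul_assoc]
  rw [integral_sub i1 (i2.const_mul _), integral_const_mul]

/-- For a test function `ψ` on the half-line, the radial test function with Laplacian
`2 ψ'(|x|) / |x|³`. -/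
theorem exists_radial_test {ψ : ℝ → ℝ} (hψ : ContDiff ℝ ∞ ψ) (hc : HasCompactSupport ψ)
    (hs : tsupport ψ ⊆ Ioi 0) :
    ∃ φ : E4 → ℝ, ContDiff ℝ ∞ φ ∧ HasCompactSupport φ ∧
      (∀ x, x ≠ 0 → (Δ φ) x = 2 * deriv ψ ‖x‖ / ‖x‖ ^ 3) ∧
      ∀ x, x ≠ 0 → φ x = -∫ ρ in Ioi (0 : ℝ), deriv ψ ρ * (max ‖x‖ ρ ^ 2)⁻¹ := by
  obtain ⟨a, b, ha, hab, habs⟩ := exists_Ioo_of_tsupport hc hs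
  have hb : 0 < b := ha.trans hab
  have hψ0 : ∀ r, r ∉ Ioo a b → ψ r = 0 := fun r hr => by
    by_contra hne
    exact hr (habs (subset_tsupport _ hne))
  obtain ⟨hψd, hψ1⟩ := contDiff_infty_iff_deriv.1 hψ
  have hψ'0 : ∀ r, r ∉ Ioo a b → deriv ψ r = 0 := fun r hr => by
    by_contra hne
    exact hr (habs (tsupport_deriv_subset (subset_tsupport _ hne)))
  -- For `φ(x) = F(|x|²)` with `F' = k`, the radial derivative is `2 r k(r²) = 2 ψ(r) / r³`. Since
  -- `Δφ = r⁻³ (r³ φ')'`, this gives `2 ψ' / r³`.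
  set k : ℝ → ℝ := fun s => ψ (√s) / s ^ 2 with hk
  have hk0 : ∀ s, s ∉ Ioo (a ^ 2) (b ^ 2) → k s = 0 := fun s hs => by
    simp only [hk]
    rw [hψ0, zero_div]
    rintro ⟨h1, h2⟩
    exact hs ⟨(Real.lt_sqrt ha.le).1 h1, (Real.sqrt_lt' hb).1 h2⟩
  have hkd : ContDiff ℝ ∞ k := by
    rw [contDiff_iff_contDiffAt]
    intro s
    rcases lt_or_ge s (a ^ 2) with h | h
    · have : k =ᶠ[𝓝 s] fun _ => 0 := by
        filter_upwards [Iio_mem_nhds h] with t ht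
        exact hk0 t fun h' => absurd h'.1 (not_lt.2 (le_of_lt ht))
      exact contDiffAt_const.congr_of_eventuallyEq this
    · have hs0 : s ≠ 0 := by have := pow_pos ha 2; linarith [this, h] |> ne_of_gt
      exact (hψ.contDiffAt.comp s (Real.contDiffAt_sqrt hs0)).div (contDiffAt_id.pow 2)
        (pow_ne_zero 2 hs0)
  -- Starting the primitive at `b ^ 2`, beyond the support of `k`, makes `φ` vanish outside a ball.
  set F : ℝ → ℝ := fun s => ∫ t in (b ^ 2)..s, k t with hF
  have hFd : ContDiff ℝ ∞ F := contDiff_primitive hkd _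
  have hF' : ∀ s, HasDerivAt F (k s) s := hasDerivAt_primitive hkd.continuous _
  have hFb : ∀ s, b ^ 2 ≤ s → F s = 0 := by
    intro s hs
    simp only [hF]
    rw [intervalIntegral.integral_of_le hs, setIntegral_eq_zero_of_forall_eq_zero]
    intro t ht
    exact hk0 t fun h => absurd h.2 (not_lt.2 ht.1.le)
  refine ⟨fun x => F (‖x‖ ^ 2), hFd.comp (contDiff_norm_sq ℝ), ?_, ?_, ?_⟩
  · refine HasCompactSupport.of_support_subset_isCompact (isCompact_closedBall (0 : E4) b) ?_
    intro x hx
    rw [mem_closedBall_zero_iff]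
    by_contra hlt
    exact hx (hFb _ (pow_le_pow_left₀ hb.le (not_le.1 hlt).le 2))
  · intro x hx
    have hr : 0 < ‖x‖ := norm_pos_iff.2 hx
    rw [laplacian_comp_norm_sq hFd]
    have e1 : deriv F = k := funext fun s => (hF' s).deriv
    have hsq : √(‖x‖ ^ 2) = ‖x‖ := Real.sqrt_sq hr.le
    have e2 : HasDerivAt k ((deriv ψ ‖x‖ * (1 / (2 * ‖x‖)) * (‖x‖ ^ 2) ^ 2 -
        ψ ‖x‖ * (2 * ‖x‖ ^ 2)) / ((‖x‖ ^ 2) ^ 2) ^ 2) (‖x‖ ^ 2) := by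
      have d1 : HasDerivAt (fun s => ψ (√s)) (deriv ψ ‖x‖ * (1 / (2 * ‖x‖))) (‖x‖ ^ 2) := by
        have := (hψd (√(‖x‖ ^ 2))).hasDerivAt.comp (‖x‖ ^ 2)
          (Real.hasDerivAt_sqrt (by positivity : ‖x‖ ^ 2 ≠ 0))
        rw [hsq] at this
        exact this
      have d2 : HasDerivAt (fun s : ℝ => s ^ 2) (2 * ‖x‖ ^ 2) (‖x‖ ^ 2) := by
        simpa using hasDerivAt_pow 2 (‖x‖ ^ 2)
      have := d1.div d2 (by positivity)
      rw [hsq] at this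
      exact this
    rw [e1, e2.deriv]
    simp only [hk, hsq]
    field_simp
    ring
  · intro x hx
    have hr : 0 < ‖x‖ := norm_pos_iff.2 hx
    set r := ‖x‖
    set B := max r b with hB
    have hrB : r ≤ B := le_max_left _ _
    have hmi : ∀ s t : ℝ, IntervalIntegrable (fun ρ => deriv ψ ρ * (max r ρ ^ 2)⁻¹) volume s t := by
      intro s t
      refine Continuous.intervalIntegrable (hψ1.continuous.mul (Continuous.inv₀ (by fun_prop) ?_)) _ _
      intro ρ
      have : 0 < max r ρ := lt_max_of_lt_left hr
      positivity
    have e0 : ∫ ρ in Ioi (0 : ℝ), deriv ψ ρ * (max r ρ ^ 2)⁻¹ =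
        ∫ ρ in (0 : ℝ)..B, deriv ψ ρ * (max r ρ ^ 2)⁻¹ := by
      rw [intervalIntegral.integral_of_le (hr.le.trans hrB)]
      refine setIntegral_eq_of_subset_of_forall_sdiff_eq_zero measurableSet_Ioi Ioc_subset_Ioi_self ?_
      rintro ρ ⟨h1, h2⟩
      rw [hψ'0, zero_mul]
      intro h3
      exact h2 ⟨h1, h3.2.le.trans (le_max_right _ _)⟩
    have e1 : ∫ ρ in (0 : ℝ)..r, deriv ψ ρ * (max r ρ ^ 2)⁻¹ = ψ r * (r ^ 2)⁻¹ := by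
      have : ∫ ρ in (0 : ℝ)..r, deriv ψ ρ * (max r ρ ^ 2)⁻¹ =
          ∫ ρ in (0 : ℝ)..r, deriv ψ ρ * (r ^ 2)⁻¹ := by
        refine intervalIntegral.integral_congr fun ρ hρ => ?_
        rw [uIcc_of_le hr.le] at hρ
        rw [max_eq_left hρ.2]
      rw [this, intervalIntegral.integral_mul_const, intervalIntegral.integral_deriv_eq_sub
        (fun y _ => hψd y) (hψ1.continuous.intervalIntegrable _ _), hψ0 0 fun h => by linarith [h.1]]
      ring
    have e2 : ∫ ρ in r..B, deriv ψ ρ * (max r ρ ^ 2)⁻¹ = - (ψ r * (r ^ 2)⁻¹) - F (r ^ 2) := by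
      -- An explicit antiderivative: the term `-2 ψ ρ⁻³` from the product rule cancels against `2ρ
      -- k(ρ²)`.
      have hd : ∀ ρ ∈ uIcc r B, HasDerivAt (fun ρ => ψ ρ * (ρ ^ 2)⁻¹ + F (ρ ^ 2))
          (deriv ψ ρ * (max r ρ ^ 2)⁻¹) ρ := by
        intro ρ hρ
        rw [uIcc_of_le hrB] at hρ
        have hρ0 : 0 < ρ := hr.trans_le hρ.1
        rw [max_eq_right hρ.1]
        have d0 : HasDerivAt (fun ρ : ℝ => ρ ^ 2) (2 * ρ) ρ := by simpa using hasDerivAt_pow 2 ρ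
        have d1 := (hψd ρ).hasDerivAt.mul (d0.inv (by positivity))
        have d2 := (hF' (ρ ^ 2)).comp ρ d0
        refine (d1.add d2).congr_deriv ?_
        simp only [hk, Real.sqrt_sq hρ0.le, Pi.inv_apply]
        field_simp
        ring
      rw [intervalIntegral.integral_eq_sub_of_hasDerivAt hd (hmi _ _),
        hψ0 B fun h => absurd h.2 (not_lt.2 (le_max_right _ _)),
        hFb (B ^ 2) (pow_le_pow_left₀ hb.le (le_max_right _ _) 2)]
      ring
    rw [e0, ← intervalIntegral.integral_add_adjacent_intervals (hmi 0 r) (hmi r B), e1, e2]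
    ring

/-! ### The weight and the size of the kernel energy -/

/-- The radial profile of `weight`. -/
def weightProfile (β : ℝ) (χ : ℝ → ℝ) (r : ℝ) : ℝ :=
  if r < 1 then Real.log (Real.exp 1 / r) ^ β else χ r

theorem measurable_weightProfile (β : ℝ) {χ : ℝ → ℝ} (hχ : ContinuousOn χ (Ici 1)) :
    Measurable (weightProfile β χ) := by
  have h1 : Measurable (fun r : ℝ => χ (max 1 r)) :=
    (hχ.comp_continuous (continuous_const.max continuous_id)
      fun x => mem_Ici.2 (le_max_left _ _)).measurable
  have h2 : Measurable (fun r : ℝ => Real.log (Real.exp 1 / r) ^ β) :=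
    (Real.measurable_log.comp (measurable_const.div measurable_id)).pow_const β
  have h3 : Measurable fun r : ℝ => if r < 1 then Real.log (Real.exp 1 / r) ^ β else χ (max 1 r) :=
    Measurable.ite measurableSet_Iio h2 h1
  convert h3 using 1
  funext r
  by_cases hr : r < 1
  · simp [weightProfile, hr]
  · simp [weightProfile, hr, max_eq_right (not_lt.1 hr)]

theorem log_exp_one_div {r : ℝ} (hr : 0 < r) : Real.log (Real.exp 1 / r) = 1 - Real.log r := by
  rw [Real.log_div (Real.exp_pos 1).ne' hr.ne', Real.log_exp]

theorem one_le_weightProfile {β : ℝ} (hβ : 0 < β) {χ : ℝ → ℝ} {r : ℝ} (hr : 0 < r) (h1 : r < 1) :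
    1 ≤ weightProfile β χ r := by
  rw [weightProfile, if_pos h1, log_exp_one_div hr]
  exact Real.one_le_rpow (by linarith [Real.log_neg hr h1]) hβ.le

theorem weightProfile_pos {β : ℝ} (hβ : 0 < β) {χ : ℝ → ℝ} (hpos : ∀ t, 1 ≤ t → 0 < χ t) {r : ℝ}
    (hr : 0 < r) : 0 < weightProfile β χ r := by
  rcases lt_or_ge r 1 with h | h
  · exact one_pos.trans_le (one_le_weightProfile hβ hr h)
  · rw [weightProfile, if_neg (not_lt.2 h)]; exact hpos r h

/-- The squared dual norm of the kernel `max (r, |y|)⁻²` with respect to the weight. -/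
def kernelEnergy (β : ℝ) (χ : ℝ → ℝ) (r : ℝ) : ℝ≥0∞ :=
  ∫⁻ y : E4, ENNReal.ofReal ((weight β χ y)⁻¹ * (max r ‖y‖ ^ 4)⁻¹)

/-- The energy `∫ ω_β f²` as an extended nonnegative number. -/
def energy (β : ℝ) (χ : ℝ → ℝ) (f : E4 → ℝ) : ℝ≥0∞ :=
  ∫⁻ y : E4, ENNReal.ofReal (weight β χ y * f y ^ 2)

section

variable {β : ℝ} {χ : ℝ → ℝ}

theorem measurable_kernelEnergy (hχ : ContinuousOn χ (Ici 1)) :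
    Measurable (kernelEnergy β χ) := by
  have := measurable_weight β hχ
  unfold kernelEnergy
  refine Measurable.lintegral_prod_right' (f := fun z : ℝ × E4 =>
    ENNReal.ofReal ((weight β χ z.2)⁻¹ * (max z.1 ‖z.2‖ ^ 4)⁻¹)) ?_
  fun_prop

theorem kernelEnergy_eq (hχ : ContinuousOn χ (Ici 1)) (r : ℝ) :
    kernelEnergy β χ r = ENNReal.ofReal (2 * Real.pi ^ 2) * ∫⁻ t in Ioi (0 : ℝ),
      ENNReal.ofReal (t ^ 3) * ENNReal.ofReal ((weightProfile β χ t)⁻¹ * (max r t ^ 4)⁻¹) := by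
  have := measurable_weightProfile β hχ
  exact lintegral_radial (G := fun t => ENNReal.ofReal ((weightProfile β χ t)⁻¹ * (max r t ^ 4)⁻¹))
    (by fun_prop)

theorem lintegral_log_rpow_le (h1 : β < 1) {r : ℝ} (hr : 0 < r) (hr1 : r < 1) :
    ∫⁻ t in Ioc r 1, ENNReal.ofReal (t⁻¹ * (1 - Real.log t) ^ (-β)) ≤
      ENNReal.ofReal ((1 - Real.log r) ^ (1 - β) / (1 - β)) := by
  have hβ : 0 < 1 - β := by linarith
  have hL : ∀ t ∈ Icc r 1, 0 < 1 - Real.log t := fun t ht => by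
    linarith [Real.log_nonpos (hr.le.trans ht.1) ht.2]
  have hc : ContinuousOn (fun t => t⁻¹ * (1 - Real.log t) ^ (-β)) (Icc r 1) := by
    intro t ht
    have ht0 : t ≠ 0 := (hr.trans_le ht.1).ne'
    exact ((continuousAt_inv₀ ht0).mul ((continuousAt_const.sub
      (Real.continuousAt_log ht0)).rpow_const (Or.inl (hL t ht).ne'))).continuousWithinAt
  have hi : IntervalIntegrable (fun t => t⁻¹ * (1 - Real.log t) ^ (-β)) volume r 1 :=
    ContinuousOn.intervalIntegrable (by rwa [uIcc_of_le hr1.le])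
  rw [← ofReal_integral_eq_lintegral_ofReal hi.1, ← intervalIntegral.integral_of_le hr1.le]
  · refine ENNReal.ofReal_le_ofReal ?_
    have hd : ∀ t ∈ uIcc r 1, HasDerivAt (fun t => -((1 - Real.log t) ^ (1 - β) / (1 - β)))
        (t⁻¹ * (1 - Real.log t) ^ (-β)) t := by
      intro t ht
      rw [uIcc_of_le hr1.le] at ht
      have ht0 : t ≠ 0 := (hr.trans_le ht.1).ne'
      have := (((((Real.hasDerivAt_log ht0).const_sub 1).rpow_const (p := 1 - β)
        (Or.inl (hL t ht).ne')).div_const (1 - β)).neg)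
      refine this.congr_deriv ?_
      rw [show 1 - β - 1 = -β by ring]
      field_simp
    rw [intervalIntegral.integral_eq_sub_of_hasDerivAt hd hi]
    have : 0 ≤ (1 - Real.log 1) ^ (1 - β) / (1 - β) := by
      simp only [Real.log_one, sub_zero, Real.one_rpow]; positivity
    linarith
  · filter_upwards [ae_restrict_mem measurableSet_Ioc] with t ht
    have := hL t ⟨ht.1.le, ht.2⟩
    have := hr.trans ht.1
    simp only [Pi.zero_apply]
    positivity

/-- `∫ᵣ^∞ dt / (χ(t) t)`. -/
def tailMass (χ : ℝ → ℝ) (r : ℝ) : ℝ≥0∞ := ∫⁻ t in Ioi r, ENNReal.ofReal (1 / (χ t * t))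

theorem tailMass_one_lt_top (hp : ProfileAssumptions χ) : tailMass χ 1 < ⊤ := by
  have h := (hp.integrable_inv_mul_inv.mono_set Ioi_subset_Ici_self).lintegral_lt_top
  simpa [tailMass, mul_comm] using h

/-- The radii split at `r` and `1`. Below `r` the weight is at least one and the contribution is at
most `1`; between them the integrand is `t⁻¹ (1 - log t)^(-β)`, the source of the growth; beyond `1`
there remains `tailMass`. The leading coefficient must be sharp, since it fixes `alphaBeta`. -/
theorem kernelEnergy_le_of_lt_one (hβ : 0 < β) (h1 : β < 1) (hχ : ContinuousOn χ (Ici 1))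
    (hp : ProfileAssumptions χ) {r : ℝ} (hr : 0 < r) (hr1 : r < 1) :
    kernelEnergy β χ r ≤ ENNReal.ofReal (2 * Real.pi ^ 2) *
      (ENNReal.ofReal ((1 - Real.log r) ^ (1 - β) / (1 - β)) + (1 + tailMass χ 1)) := by
  rw [kernelEnergy_eq hχ]
  gcongr
  rw [← Ioc_union_Ioi_eq_Ioi zero_le_one, ← Ioc_union_Ioc_eq_Ioc hr.le hr1.le]
  refine (lintegral_union_le _ _ _).trans ?_
  refine (add_le_add_left (lintegral_union_le _ _ _) _).trans ?_
  rw [← add_assoc, add_comm (ENNReal.ofReal _) 1]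
  refine add_le_add (add_le_add ?_ ?_) ?_
  · calc
      _ ≤ ∫⁻ t in Ioc 0 r, ENNReal.ofReal (r⁻¹) := by
        refine setLIntegral_mono' measurableSet_Ioc fun t ht => ?_
        rw [← ENNReal.ofReal_mul (pow_nonneg ht.1.le 3)]
        refine ENNReal.ofReal_le_ofReal ?_
        rw [max_eq_left ht.2]
        have e1 : (weightProfile β χ t)⁻¹ ≤ 1 :=
          inv_le_one_of_one_le₀ (one_le_weightProfile hβ ht.1 (ht.2.trans_lt hr1))
        calc t ^ 3 * ((weightProfile β χ t)⁻¹ * (r ^ 4)⁻¹) ≤ r ^ 3 * (1 * (r ^ 4)⁻¹) := by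
              have := ht.1.le
              have := weightProfile_pos hβ hp.pos ht.1
              gcongr
              exact ht.2
          _ = r⁻¹ := by field_simp
      _ = 1 := by
        simp only [lintegral_const, Measure.restrict_apply_univ, Real.volume_Ioc, sub_zero]
        rw [← ENNReal.ofReal_mul (by positivity), inv_mul_cancel₀ hr.ne', ENNReal.ofReal_one]
  · refine le_trans (le_of_eq ?_) (lintegral_log_rpow_le h1 hr hr1)
    -- At `t = 1` the profile has already switched to `χ`, so this null endpoint is dropped.
    rw [← restrict_Ioo_eq_restrict_Ioc]
    refine setLIntegral_congr_fun measurableSet_Ioo fun t ht => ?_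
    have ht0 : 0 < t := hr.trans ht.1
    rw [← ENNReal.ofReal_mul (pow_nonneg ht0.le 3)]
    rw [max_eq_right ht.1.le, weightProfile, if_pos ht.2, log_exp_one_div ht0,
      Real.rpow_neg (by linarith [Real.log_neg ht0 ht.2])]
    congr 1
    field_simp
  · refine le_of_eq (setLIntegral_congr_fun measurableSet_Ioi fun t ht => ?_)
    have ht1 : (1 : ℝ) < t := ht
    have ht0 : 0 < t := one_pos.trans ht
    rw [← ENNReal.ofReal_mul (pow_nonneg ht0.le 3)]
    rw [max_eq_right (hr1.trans ht1).le, weightProfile, if_neg (not_lt.2 ht1.le)]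
    congr 1
    have := hp.pos t ht1.le
    field_simp

/-- The same splitting with the order of `1` and `r` exchanged. On `(1, r]` the estimate `t² ≤ r²`
trades `t³ / r⁴` for `t / r²`, so that the last two terms have the form occurring in `ConditionD2`
and `ConditionD1`. -/
theorem kernelEnergy_le_of_one_le (hβ : 0 < β) (hχ : ContinuousOn χ (Ici 1))
    (hp : ProfileAssumptions χ) {r : ℝ} (hr : 1 ≤ r) :
    kernelEnergy β χ r ≤ ENNReal.ofReal (2 * Real.pi ^ 2) *
      (ENNReal.ofReal ((r ^ 4)⁻¹) + ENNReal.ofReal ((r ^ 2)⁻¹) *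
        (∫⁻ t in Ioc 1 r, ENNReal.ofReal (t / χ t)) + tailMass χ r) := by
  have hr0 : 0 < r := one_pos.trans_le hr
  rw [kernelEnergy_eq hχ]
  gcongr
  rw [← Ioc_union_Ioi_eq_Ioi hr0.le, ← Ioc_union_Ioc_eq_Ioc zero_le_one hr]
  refine (lintegral_union_le _ _ _).trans ?_
  refine (add_le_add_left (lintegral_union_le _ _ _) _).trans ?_
  refine add_le_add (add_le_add ?_ ?_) ?_
  · calc
      _ = ∫⁻ t in Ioo (0 : ℝ) 1, ENNReal.ofReal (t ^ 3) *
          ENNReal.ofReal ((weightProfile β χ t)⁻¹ * (max r t ^ 4)⁻¹) := by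
        rw [restrict_Ioo_eq_restrict_Ioc]
      _ ≤ ∫⁻ t in Ioo (0 : ℝ) 1, ENNReal.ofReal ((r ^ 4)⁻¹) := by
        refine setLIntegral_mono' measurableSet_Ioo fun t ht => ?_
        rw [← ENNReal.ofReal_mul (pow_nonneg ht.1.le 3)]
        refine ENNReal.ofReal_le_ofReal ?_
        rw [max_eq_left (ht.2.le.trans hr)]
        have e1 : (weightProfile β χ t)⁻¹ ≤ 1 :=
          inv_le_one_of_one_le₀ (one_le_weightProfile hβ ht.1 ht.2)
        calc t ^ 3 * ((weightProfile β χ t)⁻¹ * (r ^ 4)⁻¹) ≤ 1 * (1 * (r ^ 4)⁻¹) := by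
              have := ht.1.le
              have := weightProfile_pos hβ hp.pos ht.1
              gcongr
              exact pow_le_one₀ ht.1.le ht.2.le
          _ = (r ^ 4)⁻¹ := by ring
      _ = _ := by simp
  · rw [← lintegral_const_mul' _ _ ENNReal.ofReal_ne_top]
    refine setLIntegral_mono' measurableSet_Ioc fun t ht => ?_
    have ht0 : 0 < t := one_pos.trans ht.1
    have hc := hp.pos t ht.1.le
    rw [← ENNReal.ofReal_mul (pow_nonneg ht0.le 3), ← ENNReal.ofReal_mul (by positivity)]
    refine ENNReal.ofReal_le_ofReal ?_
    rw [max_eq_left ht.2, weightProfile, if_neg (not_lt.2 ht.1.le)]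
    calc t ^ 3 * ((χ t)⁻¹ * (r ^ 4)⁻¹) = t ^ 2 * (t / χ t * (r ^ 4)⁻¹) := by
          field_simp
      _ ≤ r ^ 2 * (t / χ t * (r ^ 4)⁻¹) := by
          gcongr
          exact ht.2
      _ = (r ^ 2)⁻¹ * (t / χ t) := by field_simp
  · refine le_of_eq (setLIntegral_congr_fun measurableSet_Ioi fun t ht => ?_)
    have ht1 : (1 : ℝ) < t := lt_of_le_of_lt hr ht
    have ht0 : 0 < t := one_pos.trans ht1
    rw [← ENNReal.ofReal_mul (pow_nonneg ht0.le 3)]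
    rw [max_eq_right (le_of_lt ht), weightProfile, if_neg (not_lt.2 ht1.le)]
    congr 1
    have := hp.pos t ht1.le
    field_simp

theorem kernelEnergy_antitone {r s : ℝ} (hβ : 0 < β) (hp : ProfileAssumptions χ) (hr : 0 < r)
    (hrs : r ≤ s) :
    kernelEnergy β χ s ≤ kernelEnergy β χ r := by
  refine lintegral_mono_ae ?_
  have h0 : ∀ᵐ x : E4, x ≠ 0 := by simp [ae_iff]
  filter_upwards [h0] with y hy
  refine ENNReal.ofReal_le_ofReal ?_
  have h1 : 0 < weight β χ y := weightProfile_pos hβ hp.pos (norm_pos_iff.2 hy)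
  have h2 : 0 < max r ‖y‖ := lt_max_of_lt_left hr
  gcongr

theorem kernelEnergy_lt_top (hβ : 0 < β) (h1 : β < 1) (hχ : ContinuousOn χ (Ici 1))
    (hp : ProfileAssumptions χ) {r : ℝ} (hr : 0 < r) : kernelEnergy β χ r < ⊤ := by
  have hm : 0 < min r (1 / 2) := lt_min hr (by norm_num)
  refine (kernelEnergy_antitone hβ hp hm (min_le_left _ _)).trans_lt ?_
  refine (kernelEnergy_le_of_lt_one hβ h1 hχ hp hm
    ((min_le_right _ _).trans_lt (by norm_num))).trans_lt ?_
  refine ENNReal.mul_lt_top ENNReal.ofReal_lt_top ?_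
  have := tailMass_one_lt_top hp
  finiteness

theorem add_rpow_le_two_rpow_mul {s : ℝ} (hs : 1 ≤ s) (a b : ℝ≥0∞) :
    (a + b) ^ s ≤ 2 ^ s * (a ^ s + b ^ s) := by
  refine (ENNReal.rpow_add_le_mul_rpow_add_rpow a b hs).trans ?_
  gcongr
  · norm_num
  · linarith

/-- The three terms of `kernelEnergy_le_of_one_le` are raised to the power `s = 1/(1-β)`. The first
is integrable because `s > 1`, the others by the two conditions with `k = 1`. The result serves both
to exclude additive constants in the potential representation and to control the exponential at
infinity. -/
theorem lintegral_kernelEnergy_rpow_lt_top (hβ : 0 < β) (h1 : β < 1) (hχ : ContinuousOn χ (Ici 1))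
    (hp : ProfileAssumptions χ) (hD1 : ConditionD1 β χ) (hD2 : ConditionD2 β χ) :
    ∫⁻ x in {x : E4 | 1 < ‖x‖}, kernelEnergy β χ ‖x‖ ^ (1 / (1 - β)) < ⊤ := by
  have hb : 0 < 1 - β := by linarith
  set s := 1 / (1 - β) with hs
  have hs1 : 1 < s := by rw [hs, lt_div_iff₀ hb]; linarith
  have hs0 : 0 ≤ s := by linarith
  have hmS := measurable_kernelEnergy (β := β) hχ
  have e0 : ∫⁻ x in {x : E4 | 1 < ‖x‖}, kernelEnergy β χ ‖x‖ ^ s =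
      ENNReal.ofReal (2 * Real.pi ^ 2) *
        ∫⁻ r in Ioi (1 : ℝ), ENNReal.ofReal (r ^ 3) * kernelEnergy β χ r ^ s := by
    rw [← lintegral_indicator (measurableSet_lt measurable_const measurable_norm)]
    have : ∀ x : E4, ({x : E4 | 1 < ‖x‖}.indicator (fun x => kernelEnergy β χ ‖x‖ ^ s)) x =
        (Ioi (1 : ℝ)).indicator (fun r => kernelEnergy β χ r ^ s) ‖x‖ := fun x => rfl
    simp_rw [this]
    rw [lintegral_radial ((hmS.pow_const _).indicator measurableSet_Ioi)]
    congr 1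
    have : ∀ r, ENNReal.ofReal (r ^ 3) * (Ioi (1 : ℝ)).indicator (fun r => kernelEnergy β χ r ^ s) r
        = (Ioi (1 : ℝ)).indicator (fun r => ENNReal.ofReal (r ^ 3) * kernelEnergy β χ r ^ s) r := by
      intro r
      by_cases h : r ∈ Ioi (1 : ℝ) <;> simp [h]
    simp_rw [this]
    rw [setLIntegral_indicator measurableSet_Ioi,
      inter_eq_left.2 (Ioi_subset_Ioi zero_le_one)]
  rw [e0]
  refine ENNReal.mul_lt_top ENNReal.ofReal_lt_top ?_
  obtain ⟨C₁, -, hD1⟩ := hD1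
  obtain ⟨C₂, -, hD2⟩ := hD2
  have d1 := (hD1 1 le_rfl).trans ENNReal.ofReal_lt_top
  have d2 := (hD2 1 le_rfl).trans ENNReal.ofReal_lt_top
  simp only [Nat.cast_one, mul_one, ← hs] at d1 d2
  have d0 : ∫⁻ r in Ioi (1 : ℝ), ENNReal.ofReal (r ^ (3 - 4 * s)) < ⊤ :=
    (integrableOn_Ioi_rpow_of_lt (by linarith) one_pos).lintegral_lt_top
  set A : ℝ → ℝ≥0∞ := fun r => ENNReal.ofReal (r ^ (3 - 4 * s))
  set B : ℝ → ℝ≥0∞ := fun r => ENNReal.ofReal (r ^ (3 - 2 / (1 - β))) *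
    (∫⁻ y in Ioc 1 r, ENNReal.ofReal (y / χ y)) ^ s
  set D : ℝ → ℝ≥0∞ := fun r => ENNReal.ofReal (r ^ 3) *
    (∫⁻ y in Ioi r, ENNReal.ofReal (1 / (χ y * y))) ^ s
  have hA : Measurable A := by fun_prop
  have hB : Measurable B := by
    refine Measurable.mul (by fun_prop) (Measurable.pow_const ?_ _)
    refine Monotone.measurable fun a b hab => ?_
    exact lintegral_mono_set (Ioc_subset_Ioc_right hab)
  have hbound : ∀ r ∈ Ioi (1 : ℝ), ENNReal.ofReal (r ^ 3) * kernelEnergy β χ r ^ s ≤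
      (ENNReal.ofReal (2 * Real.pi ^ 2) ^ s * (2 ^ s * 2 ^ s)) * (A r + B r + D r) := by
    intro r hr
    have hr1 : (1 : ℝ) < r := hr
    have hr0 : 0 < r := one_pos.trans hr
    set a := ENNReal.ofReal ((r ^ 4)⁻¹)
    set b := ∫⁻ t in Ioc 1 r, ENNReal.ofReal (t / χ t)
    set p := ENNReal.ofReal ((r ^ 2)⁻¹)
    set d := tailMass χ r
    have two : (1 : ℝ≥0∞) ≤ 2 ^ s := ENNReal.one_le_rpow (by norm_num) (by linarith)
    have c1 : kernelEnergy β χ r ^ s ≤ ENNReal.ofReal (2 * Real.pi ^ 2) ^ s *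
        ((2 ^ s * 2 ^ s) * (a ^ s + (p * b) ^ s + d ^ s)) := by
      calc kernelEnergy β χ r ^ s ≤ (ENNReal.ofReal (2 * Real.pi ^ 2) * (a + p * b + d)) ^ s :=
            ENNReal.rpow_le_rpow (kernelEnergy_le_of_one_le hβ hχ hp hr1.le) hs0
        _ = ENNReal.ofReal (2 * Real.pi ^ 2) ^ s * (a + p * b + d) ^ s :=
            ENNReal.mul_rpow_of_nonneg _ _ hs0
        _ ≤ ENNReal.ofReal (2 * Real.pi ^ 2) ^ s *
            (2 ^ s * (2 ^ s * (a ^ s + (p * b) ^ s) + 2 ^ s * d ^ s)) := by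
          gcongr
          refine (add_rpow_le_two_rpow_mul hs1.le _ _).trans ?_
          gcongr
          · exact add_rpow_le_two_rpow_mul hs1.le _ _
          · exact le_mul_of_one_le_left' two
        _ = _ := by ring
    have ea : ENNReal.ofReal (r ^ 3) * a ^ s = A r := by
      simp only [a, A]
      rw [ENNReal.ofReal_rpow_of_pos (by positivity), ← ENNReal.ofReal_mul (by positivity)]
      congr 1
      rw [Real.rpow_sub hr0, ← Real.rpow_natCast r 4, ← Real.rpow_neg hr0.le, ← Real.rpow_mul hr0.le,
        neg_mul, Real.rpow_neg hr0.le]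
      norm_cast
    have eb : ENNReal.ofReal (r ^ 3) * (p * b) ^ s = B r := by
      simp only [p, B]
      rw [ENNReal.mul_rpow_of_nonneg _ _ hs0, ENNReal.ofReal_rpow_of_pos (by positivity), ← mul_assoc,
        ← ENNReal.ofReal_mul (by positivity)]
      congr 2
      rw [Real.rpow_sub hr0, ← Real.rpow_natCast r 2, ← Real.rpow_neg hr0.le, ← Real.rpow_mul hr0.le,
        neg_mul, Real.rpow_neg hr0.le, show (2 : ℝ) / (1 - β) = ((2 : ℕ) : ℝ) * s by
          rw [hs]; push_cast; ring]
      norm_cast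
    calc ENNReal.ofReal (r ^ 3) * kernelEnergy β χ r ^ s ≤ ENNReal.ofReal (r ^ 3) *
        (ENNReal.ofReal (2 * Real.pi ^ 2) ^ s * ((2 ^ s * 2 ^ s) * (a ^ s + (p * b) ^ s + d ^ s))) := by
          gcongr
      _ = (ENNReal.ofReal (2 * Real.pi ^ 2) ^ s * (2 ^ s * 2 ^ s)) *
          (ENNReal.ofReal (r ^ 3) * a ^ s + ENNReal.ofReal (r ^ 3) * (p * b) ^ s +
            ENNReal.ofReal (r ^ 3) * d ^ s) := by ring
      _ = _ := by rw [ea, eb]; rfl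
  refine (setLIntegral_mono' measurableSet_Ioi hbound).trans_lt ?_
  have hc : ENNReal.ofReal (2 * Real.pi ^ 2) ^ s * (2 ^ s * 2 ^ s) < ⊤ := by finiteness
  rw [lintegral_const_mul' _ _ hc.ne, lintegral_add_left (f := fun r => A r + B r) (hA.add hB),
    lintegral_add_left hA]
  exact ENNReal.mul_lt_top hc (ENNReal.add_lt_top.2 ⟨ENNReal.add_lt_top.2 ⟨d0, d2⟩, d1⟩)

/-- The Cauchy–Schwarz bound for the radial potential. -/
theorem lintegral_mul_kernel_le (hβ : 0 < β) (hχ : ContinuousOn χ (Ici 1))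
    (hp : ProfileAssumptions χ) {f : E4 → ℝ} (hf : AEMeasurable f) {r : ℝ} (hr : 0 < r) :
    ∫⁻ y : E4, ENNReal.ofReal (|f y| * (max r ‖y‖ ^ 2)⁻¹) ≤
      energy β χ f ^ (1 / 2 : ℝ) * kernelEnergy β χ r ^ (1 / 2 : ℝ) := by
  have hw := measurable_weight β hχ
  have h0 : ∀ᵐ x : E4, x ≠ 0 := by simp [ae_iff]
  have h := ENNReal.lintegral_mul_le_Lp_mul_Lq (volume : Measure E4) Real.HolderConjugate.two_two
    (f := fun y => ENNReal.ofReal (√(weight β χ y) * |f y|))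
    (g := fun y => ENNReal.ofReal ((√(weight β χ y))⁻¹ * (max r ‖y‖ ^ 2)⁻¹))
    (by fun_prop) (by fun_prop)
  convert h using 1
  · refine lintegral_congr_ae ?_
    filter_upwards [h0] with y hy
    have h1 : 0 < weight β χ y := weightProfile_pos hβ hp.pos (norm_pos_iff.2 hy)
    rw [Pi.mul_apply, ← ENNReal.ofReal_mul (by positivity)]
    congr 1
    have := Real.sqrt_pos.2 h1
    field_simp
  · congr 2
    · refine lintegral_congr_ae ?_
      filter_upwards [h0] with y hy
      have h1 : 0 < weight β χ y := weightProfile_pos hβ hp.pos (norm_pos_iff.2 hy)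
      rw [ENNReal.ofReal_rpow_of_nonneg (by positivity) (by norm_num)]
      congr 1
      simp [mul_pow, Real.sq_sqrt h1.le]
    · refine lintegral_congr_ae ?_
      filter_upwards [h0] with y hy
      have h1 : 0 < weight β χ y := weightProfile_pos hβ hp.pos (norm_pos_iff.2 hy)
      rw [ENNReal.ofReal_rpow_of_nonneg (by positivity) (by norm_num)]
      congr 1
      rw [Real.rpow_two, mul_pow, inv_pow, inv_pow, Real.sq_sqrt h1.le]
      ring

end

/-! ### Representation of radial functions by their potential -/

section

variable {β : ℝ} {χ : ℝ → ℝ}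

/-- `-4π²` times the radial Newtonian potential of `f` on `ℝ⁴`. -/
def radialPotential (f : E4 → ℝ) (r : ℝ) : ℝ := ∫ y, f y * (max r ‖y‖ ^ 2)⁻¹

theorem max_pow_inv_nonneg (r : ℝ) (y : E4) : 0 ≤ (max r ‖y‖ ^ 2)⁻¹ := by positivity

theorem aestronglyMeasurable_mul_kernel {f : E4 → ℝ} (hf : AEStronglyMeasurable f) (r : ℝ) :
    AEStronglyMeasurable (fun y : E4 => f y * (max r ‖y‖ ^ 2)⁻¹) := by
  refine hf.mul (Measurable.aestronglyMeasurable ?_)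
  fun_prop

theorem enorm_mul_kernel (f : E4 → ℝ) (r : ℝ) (y : E4) :
    ‖f y * (max r ‖y‖ ^ 2)⁻¹‖ₑ = ENNReal.ofReal (|f y| * (max r ‖y‖ ^ 2)⁻¹) := by
  rw [Real.enorm_eq_ofReal_abs, abs_mul, abs_of_nonneg (max_pow_inv_nonneg r y)]

theorem integrable_mul_kernel (hβ : 0 < β) (h1 : β < 1) (hχ : ContinuousOn χ (Ici 1))
    (hp : ProfileAssumptions χ) {f : E4 → ℝ} (hf : AEStronglyMeasurable f)
    (hE : energy β χ f < ⊤) {r : ℝ} (hr : 0 < r) :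
    Integrable (fun y : E4 => f y * (max r ‖y‖ ^ 2)⁻¹) := by
  refine ⟨aestronglyMeasurable_mul_kernel hf r, ?_⟩
  simp only [HasFiniteIntegral, enorm_mul_kernel]
  refine (lintegral_mul_kernel_le hβ hχ hp hf.aemeasurable hr).trans_lt ?_
  have := kernelEnergy_lt_top hβ h1 hχ hp hr
  exact ENNReal.mul_lt_top (ENNReal.rpow_lt_top_of_nonneg (by norm_num) hE.ne)
    (ENNReal.rpow_lt_top_of_nonneg (by norm_num) this.ne)

theorem enorm_radialPotential_le (hβ : 0 < β) (hχ : ContinuousOn χ (Ici 1))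
    (hp : ProfileAssumptions χ) {f : E4 → ℝ} (hf : AEStronglyMeasurable f) {r : ℝ} (hr : 0 < r) :
    ‖radialPotential f r‖ₑ ≤ energy β χ f ^ (1 / 2 : ℝ) * kernelEnergy β χ r ^ (1 / 2 : ℝ) := by
  refine (enorm_integral_le_lintegral_enorm _).trans ?_
  simp only [enorm_mul_kernel]
  exact lintegral_mul_kernel_le hβ hχ hp hf.aemeasurable hr

theorem continuousOn_radialPotential (hβ : 0 < β) (h1 : β < 1) (hχ : ContinuousOn χ (Ici 1))
    (hp : ProfileAssumptions χ) {f : E4 → ℝ} (hf : AEStronglyMeasurable f)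
    (hE : energy β χ f < ⊤) : ContinuousOn (radialPotential f) (Ioi 0) := by
  intro r hr
  have hr0 : 0 < r := hr
  refine ContinuousAt.continuousWithinAt ?_
  -- The kernel decreases in its radius, so its value at `r / 2` dominates all nearby radii.
  refine continuousAt_of_dominated (bound := fun y => ‖f y * (max (r / 2) ‖y‖ ^ 2)⁻¹‖)
    (Eventually.of_forall fun s => aestronglyMeasurable_mul_kernel hf s) ?_
    (integrable_mul_kernel hβ h1 hχ hp hf hE (half_pos hr0)).norm ?_
  · filter_upwards [Ioi_mem_nhds (half_lt_self hr0)] with s hs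
    refine Eventually.of_forall fun y => ?_
    rw [norm_mul, norm_mul]
    refine mul_le_mul_of_nonneg_left ?_ (norm_nonneg _)
    rw [Real.norm_of_nonneg (max_pow_inv_nonneg _ _), Real.norm_of_nonneg (max_pow_inv_nonneg _ _)]
    have h2 : 0 < max (r / 2) ‖y‖ := lt_max_of_lt_left (half_pos hr0)
    have : r / 2 ≤ s := le_of_lt hs
    gcongr
  · refine Eventually.of_forall fun y => ?_
    have h2 : 0 < max r ‖y‖ := lt_max_of_lt_left hr0
    refine continuousAt_const.mul (ContinuousAt.inv₀ ?_ (pow_pos h2 2).ne')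
    fun_prop

theorem locallyIntegrableOn_profile {u : E4 → ℝ} {g : ℝ → ℝ} (hu : LocallyIntegrable u)
    (hg : u =ᵐ[volume] fun x => g ‖x‖) : LocallyIntegrableOn g (Ioi 0) := by
  rw [locallyIntegrableOn_iff isOpen_Ioi.isLocallyClosed]
  intro k hk hkc
  obtain ⟨b, hb⟩ := hkc.bddAbove
  have i1 : IntegrableOn (fun x : E4 => g ‖x‖) (Metric.closedBall 0 b) :=
    (hu.integrableOn_isCompact (isCompact_closedBall _ _)).congr (ae_restrict_of_ae hg)
  rw [← integrable_indicator_iff measurableSet_closedBall] at i1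
  have e : (Metric.closedBall (0 : E4) b).indicator (fun x : E4 => g ‖x‖) =
      fun x : E4 => (Iic b).indicator g ‖x‖ := by
    funext x
    by_cases h : ‖x‖ ≤ b <;> simp [indicator, h]
  rw [e, integrable_fun_norm_addHaar (volume : Measure E4) (f := (Iic b).indicator g)] at i1
  have i2 := i1.mono_set hk
  -- The Jacobian `r³` is divided out, harmless on compact sets away from `0`.
  have i3 := i2.continuousOn_mul (g := fun r => (r ^ 3)⁻¹)
    (fun r hr => by
      have hr0 : 0 < r := hk hr
      exact ((continuousAt_id.pow 3).inv₀ (pow_pos hr0 3).ne').continuousWithinAt) hkc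
  refine i3.congr_fun (fun r hr => ?_) hkc.measurableSet
  have hr0 : 0 < r := hk hr
  have hrb : r ≤ b := hb hr
  simp [indicator, hrb]
  field_simp

/-- The weak equation is tested with the function of `exists_radial_test`. On one side its Laplacian
cancels the Jacobian, leaving the factor `2 · 2π²`; on the other its integral formula and Fubini
produce the potential of `f`. Thus `4π² g + radialPotential f` has zero weak derivative. -/
theorem integral_deriv_mul_profile {u f : E4 → ℝ} {g : ℝ → ℝ} (hf : IsWeakLaplacian u f)
    (hg : u =ᵐ[volume] fun x => g ‖x‖) (hβ : 0 < β) (h1 : β < 1) (hχ : ContinuousOn χ (Ici 1))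
    (hp : ProfileAssumptions χ) (hE : energy β χ f < ⊤) {ψ : ℝ → ℝ}
    (hψ : ContDiff ℝ ∞ ψ) (hc : HasCompactSupport ψ) (hs : tsupport ψ ⊆ Ioi 0) :
    4 * Real.pi ^ 2 * ∫ r, deriv ψ r * g r = -∫ r, deriv ψ r * radialPotential f r := by
  obtain ⟨φ, hφ, hφc, hΔ, hφe⟩ := exists_radial_test hψ hc hs
  have hne : ∀ᵐ x : E4, x ≠ 0 := by simp [ae_iff]
  obtain ⟨-, hψ1⟩ := contDiff_infty_iff_deriv.1 hψ
  have hs' : tsupport (deriv ψ) ⊆ Ioi 0 := tsupport_deriv_subset.trans hs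
  obtain ⟨a, b, ha, -, hab⟩ := exists_Ioo_of_tsupport hc.deriv hs'
  have hψ0 : ∀ r, r ≤ a → deriv ψ r = 0 := fun r hr => by
    by_contra hne
    exact absurd (hab (subset_tsupport _ hne)).1 (not_lt.2 hr)
  have hIoi : ∀ w : ℝ → ℝ, ∫ r in Ioi (0 : ℝ), deriv ψ r * w r = ∫ r, deriv ψ r * w r := fun w => by
    refine setIntegral_eq_integral_of_forall_compl_eq_zero fun r hr => ?_
    rw [hψ0 r ((not_lt.1 hr).trans ha.le), zero_mul]
  have e1 : ∫ x, (Δ φ) x * u x = 4 * Real.pi ^ 2 * ∫ r, deriv ψ r * g r := by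
    have : ∫ x, (Δ φ) x * u x = ∫ x : E4, 2 * deriv ψ ‖x‖ / ‖x‖ ^ 3 * g ‖x‖ := by
      refine integral_congr_ae ?_
      filter_upwards [hne, hg] with x hx hgx
      rw [hΔ x hx, hgx]
    rw [this, integral_radial (fun r => 2 * deriv ψ r / r ^ 3 * g r), ← hIoi]
    have : ∫ r in Ioi (0 : ℝ), r ^ 3 * (2 * deriv ψ r / r ^ 3 * g r) =
        ∫ r in Ioi (0 : ℝ), 2 * (deriv ψ r * g r) := by
      refine setIntegral_congr_fun measurableSet_Ioi fun r hr => ?_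
      have hr0 : r ≠ 0 := ne_of_gt hr
      field_simp
    rw [this, integral_const_mul]
    ring
  have e2 : ∫ x, φ x * f x = -∫ r, deriv ψ r * radialPotential f r := by
    -- Domination for Fubini: `ψ'` vanishes up to the radius `a`, and beyond it the kernel is at
    -- most its value at `a`.
    have i1 : Integrable (fun z : E4 × ℝ => (f z.1 * (max a ‖z.1‖ ^ 2)⁻¹) * deriv ψ z.2)
        ((volume : Measure E4).prod (volume.restrict (Ioi 0))) :=
      (integrable_mul_kernel hβ h1 hχ hp hf.right.aestronglyMeasurable hE ha).mul_prod
        (hψ1.continuous.integrable_of_hasCompactSupport hc.deriv).integrableOn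
    have i2 : Integrable (Function.uncurry fun (y : E4) (ρ : ℝ) =>
        deriv ψ ρ * (f y * (max ρ ‖y‖ ^ 2)⁻¹))
        ((volume : Measure E4).prod (volume.restrict (Ioi 0))) := by
      refine i1.mono ?_ (Eventually.of_forall ?_)
      · refine (hψ1.continuous.comp continuous_snd).aestronglyMeasurable.mul
          (hf.right.aestronglyMeasurable.comp_fst.mul (Measurable.aestronglyMeasurable ?_))
        fun_prop
      · rintro ⟨y, ρ⟩
        simp only [Function.uncurry, norm_mul]
        rcases le_or_gt ρ a with h | h
        · rw [hψ0 ρ h]; simp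
        · have h2 : 0 < max a ‖y‖ := lt_max_of_lt_left ha
          rw [Real.norm_of_nonneg (max_pow_inv_nonneg _ _),
            Real.norm_of_nonneg (max_pow_inv_nonneg _ _), mul_comm]
          gcongr
    have e3 : ∫ x, φ x * f x =
        -∫ y : E4, ∫ ρ in Ioi (0 : ℝ), deriv ψ ρ * (f y * (max ρ ‖y‖ ^ 2)⁻¹) := by
      rw [← integral_neg]
      refine integral_congr_ae ?_
      filter_upwards [hne] with y hy
      rw [hφe y hy, neg_mul, ← integral_mul_const]
      congr 2
      funext ρ
      rw [max_comm]
      ring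
    rw [e3, integral_integral_swap i2, ← hIoi]
    simp only [integral_const_mul]
    rfl
  rw [← e1, ← e2]
  exact hf.eq φ hφ hφc

/-- A radial function with finite energy is, up to a constant, the potential of its Laplacian. -/
theorem exists_const_profile {u f : E4 → ℝ} {g : ℝ → ℝ} (hf : IsWeakLaplacian u f)
    (hg : u =ᵐ[volume] fun x => g ‖x‖) (hβ : 0 < β) (h1 : β < 1) (hχ : ContinuousOn χ (Ici 1))
    (hp : ProfileAssumptions χ) (hE : energy β χ f < ⊤) :
    ∃ c : ℝ, ∀ᵐ r : ℝ, 0 < r → 4 * Real.pi ^ 2 * g r + radialPotential f r = c := by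
  have l1 := locallyIntegrableOn_profile hf.left hg
  have l2 : LocallyIntegrableOn (radialPotential f) (Ioi 0) :=
    (continuousOn_radialPotential hβ h1 hχ hp hf.right.aestronglyMeasurable
      hE).locallyIntegrableOn measurableSet_Ioi
  have l3 : LocallyIntegrableOn (fun r => 4 * Real.pi ^ 2 * g r) (Ioi 0) := by
    exact l1.smul (4 * Real.pi ^ 2)
  refine ae_eq_const_of_integral_deriv_mul_eq_zero (l3.add l2) fun ψ hψ hc hs => ?_
  have hψ1 := (contDiff_infty_iff_deriv.1 hψ).2
  have hs' : tsupport (deriv ψ) ⊆ Ioi 0 := tsupport_deriv_subset.trans hs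
  have i3 := integrable_mul_of_locallyIntegrableOn l3 hψ1.continuous hc.deriv hs'
  have i2 := integrable_mul_of_locallyIntegrableOn l2 hψ1.continuous hc.deriv hs'
  simp only [mul_add]
  rw [integral_add i3 i2]
  have := integral_deriv_mul_profile hf hg hβ h1 hχ hp hE hψ hc hs
  simp only [mul_left_comm (deriv ψ _)]
  rw [integral_const_mul, this]
  ring

theorem volume_exterior : volume {x : E4 | 1 < ‖x‖} = ⊤ := by
  have h : (univ : Set E4) = Metric.closedBall 0 1 ∪ {x : E4 | 1 < ‖x‖} := by
    ext x
    simp [le_or_gt]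
  by_contra hne
  have h2 := measure_union_le (μ := (volume : Measure E4)) (Metric.closedBall 0 1) {x : E4 | 1 < ‖x‖}
  rw [← h, measure_univ_of_isAddLeftInvariant, top_le_iff] at h2
  exact (ENNReal.add_lt_top.2 ⟨measure_closedBall_lt_top, lt_top_iff_ne_top.2 hne⟩).ne h2

/-- Radial functions of `X_β` are the potentials of their Laplacians. -/
theorem ae_eq_radialPotential {u f : E4 → ℝ} {g : ℝ → ℝ} (hf : IsWeakLaplacian u f)
    (hg : u =ᵐ[volume] fun x => g ‖x‖) (hu : MemLp u (ENNReal.ofReal (2 / (1 - β))))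
    (hβ : 0 < β) (h1 : β < 1) (hχ : ContinuousOn χ (Ici 1)) (hp : ProfileAssumptions χ)
    (hD1 : ConditionD1 β χ) (hD2 : ConditionD2 β χ) (hE : energy β χ f < ⊤) :
    ∀ᵐ x, 4 * Real.pi ^ 2 * u x = -radialPotential f ‖x‖ := by
  obtain ⟨c, hc⟩ := exists_const_profile hf hg hβ h1 hχ hp hE
  have hb : 0 < 1 - β := by linarith
  have hq : 0 < 2 / (1 - β) := by positivity
  have hx := ae_norm_of_ae hc
  have hq0 : ENNReal.ofReal (2 / (1 - β)) ≠ 0 := by simpa using hq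
  have hmeas : MeasurableSet {x : E4 | 1 < ‖x‖} := measurableSet_lt measurable_const measurable_norm
  set μ := (volume : Measure E4).restrict {x : E4 | 1 < ‖x‖}
  -- The additive constant is zero: on the exterior of the unit ball both `u` and the potential lie
  -- in `L^(2/(1-β))`, hence so does `c`, and the exterior has infinite volume.
  have m1 : MemLp (fun x : E4 => radialPotential f ‖x‖) (ENNReal.ofReal (2 / (1 - β))) μ := by
    refine ⟨ContinuousOn.aestronglyMeasurable ?_ hmeas, ?_⟩
    · exact (continuousOn_radialPotential hβ h1 hχ hp hf.right.aestronglyMeasurable hE).comp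
        continuous_norm.continuousOn fun x hx => mem_Ioi.2 (one_pos.trans hx)
    · rw [eLpNorm_lt_top_iff_lintegral_rpow_enorm_lt_top hq0 ENNReal.ofReal_ne_top,
        ENNReal.toReal_ofReal hq.le]
      have hbound : ∀ x ∈ {x : E4 | 1 < ‖x‖}, ‖radialPotential f ‖x‖‖ₑ ^ (2 / (1 - β)) ≤
          energy β χ f ^ (1 / (1 - β)) * kernelEnergy β χ ‖x‖ ^ (1 / (1 - β)) := by
        intro x hx
        refine (ENNReal.rpow_le_rpow (enorm_radialPotential_le hβ hχ hp
          hf.right.aestronglyMeasurable (one_pos.trans hx)) hq.le).trans (le_of_eq ?_)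
        rw [ENNReal.mul_rpow_of_nonneg _ _ hq.le, ← ENNReal.rpow_mul, ← ENNReal.rpow_mul]
        congr 2 <;> ring
      refine (setLIntegral_mono' hmeas hbound).trans_lt ?_
      rw [lintegral_const_mul' _ _ (ENNReal.rpow_lt_top_of_nonneg (by positivity) hE.ne).ne]
      exact ENNReal.mul_lt_top (ENNReal.rpow_lt_top_of_nonneg (by positivity) hE.ne)
        (lintegral_kernelEnergy_rpow_lt_top hβ h1 hχ hp hD1 hD2)
  have m2 : MemLp (fun x => 4 * Real.pi ^ 2 * u x) (ENNReal.ofReal (2 / (1 - β))) μ :=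
    (hu.restrict _).const_mul _
  have m3 : MemLp (fun _ : E4 => c) (ENNReal.ofReal (2 / (1 - β))) μ := by
    refine (memLp_congr_ae ?_).1 (m2.add m1)
    refine ae_restrict_of_ae ?_
    filter_upwards [hx, hg] with x h2 h3
    rw [Pi.add_apply, h3, h2]
  rw [memLp_const_iff hq0 ENNReal.ofReal_ne_top] at m3
  have hc0 : c = 0 := by
    refine m3.resolve_right ?_
    rw [Measure.restrict_apply_univ, volume_exterior]
    exact lt_irrefl _
  filter_upwards [hx, hg] with x h2 h3
  rw [h3]
  linarith

end

/-! ### Pointwise bounds for potentials -/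

section Potential

variable {β : ℝ} {χ : ℝ → ℝ}

theorem weight_nonneg (hβ : 0 < β) (hpos : ∀ t, 1 ≤ t → 0 < χ t) (x : E4) : 0 ≤ weight β χ x := by
  -- At the origin division by zero makes the weight `0 ^ β = 0`.
  rcases eq_or_ne x 0 with rfl | hx
  · simp [weight, Real.zero_rpow hβ.ne']
  · exact (weightProfile_pos hβ hpos (norm_pos_iff.2 hx)).le

theorem abs_radialPotential_le (hβ : 0 < β) (h1 : β < 1) (hχ : ContinuousOn χ (Ici 1))
    (hp : ProfileAssumptions χ) {f : E4 → ℝ} (hf : AEStronglyMeasurable f)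
    (hE : energy β χ f < ⊤) {r : ℝ} (hr : 0 < r) :
    |radialPotential f r| ≤ √(energy β χ f).toReal * √(kernelEnergy β χ r).toReal := by
  have h := enorm_radialPotential_le hβ hχ hp hf hr
  have hS := kernelEnergy_lt_top hβ h1 hχ hp hr
  have h2 := ENNReal.toReal_mono (ENNReal.mul_lt_top
    (ENNReal.rpow_lt_top_of_nonneg (by norm_num) hE.ne)
    (ENNReal.rpow_lt_top_of_nonneg (by norm_num) hS.ne)).ne h
  rwa [ENNReal.toReal_mul, ← ENNReal.toReal_rpow, ← ENNReal.toReal_rpow, ← Real.sqrt_eq_rpow,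
    ← Real.sqrt_eq_rpow, toReal_enorm, Real.norm_eq_abs] at h2

/-- Absolute continuity of the energy integral, applied to balls of vanishing volume. -/
theorem exists_ball_energy_lt {f : E4 → ℝ} (hE : energy β χ f < ⊤) {ε : ℝ≥0∞} (hε : ε ≠ 0) :
    ∃ δ : ℝ, 0 < δ ∧ energy β χ ((Metric.ball 0 δ).indicator f) < ε := by
  obtain ⟨η, hη, h⟩ := exists_pos_setLIntegral_lt_of_measure_lt hE.ne hε
  have hv : Tendsto (fun δ : ℝ => (volume : Measure E4) (Metric.ball 0 δ)) (𝓝 0) (𝓝 0) := by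
    simp_rw [InnerProductSpace.volume_ball_of_dim_even (E := E4) (k := 2) (by simp)]
    have hc : Continuous fun δ : ℝ => ENNReal.ofReal δ ^ Module.finrank ℝ E4 *
        ENNReal.ofReal (Real.pi ^ 2 / (Nat.factorial 2 : ℝ)) :=
      (ENNReal.continuous_mul_const ENNReal.ofReal_ne_top).comp
        ((ENNReal.continuous_pow _).comp ENNReal.continuous_ofReal)
    simpa using hc.tendsto 0
  have hev : ∀ᶠ δ : ℝ in 𝓝[>] 0, (volume : Measure E4) (Metric.ball 0 δ) < η :=
    nhdsWithin_le_nhds (hv.eventually (gt_mem_nhds hη))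
  obtain ⟨δ, hδ, hδ0⟩ := (hev.and self_mem_nhdsWithin).exists
  refine ⟨δ, hδ0, lt_of_le_of_lt (le_of_eq ?_) (h _ hδ)⟩
  rw [energy, ← lintegral_indicator measurableSet_ball]
  congr 1
  funext x
  by_cases hx : x ∈ Metric.ball (0 : E4) δ <;> simp [indicator, hx]

/-- The potential of a fixed `f` is negligible against the critical growth at the origin. -/
theorem exists_abs_radialPotential_le (hβ : 0 < β) (h1 : β < 1) (hχ : ContinuousOn χ (Ici 1))
    (hp : ProfileAssumptions χ) {f : E4 → ℝ} (hf : AEStronglyMeasurable f)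
    (hE : energy β χ f < ⊤) {ε : ℝ} (hε : 0 < ε) :
    ∃ C : ℝ, 0 ≤ C ∧ ∀ r, 0 < r →
      |radialPotential f r| ≤ ε * √(kernelEnergy β χ r).toReal + C := by
  obtain ⟨δ, hδ, hδE⟩ := exists_ball_energy_lt hE (ε := ENNReal.ofReal (ε ^ 2)) (by positivity)
  -- The part of `f` near the origin has energy below `ε²` and is handled by Cauchy–Schwarz. On the
  -- remaining part `|y| ≥ δ`, so the kernel is at most `max(δ, |y|)⁻²`, uniformly in `r`.
  set f₁ := (Metric.ball 0 δ).indicator f with hf₁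
  set f₂ := (Metric.ball 0 δ)ᶜ.indicator f with hf₂
  have m₁ : AEStronglyMeasurable f₁ := hf.indicator measurableSet_ball
  have hE₁ : energy β χ f₁ < ⊤ := hδE.trans ENNReal.ofReal_lt_top
  have i0 := (integrable_mul_kernel hβ h1 hχ hp hf hE hδ).norm
  refine ⟨∫ y, ‖f y * (max δ ‖y‖ ^ 2)⁻¹‖, integral_nonneg fun _ => norm_nonneg _, fun r hr => ?_⟩
  have i := integrable_mul_kernel hβ h1 hχ hp hf hE hr
  have i₁ := integrable_mul_kernel hβ h1 hχ hp m₁ hE₁ hr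
  have i₂ : Integrable fun y => f₂ y * (max r ‖y‖ ^ 2)⁻¹ := by
    refine (i.indicator (measurableSet_ball (x := (0 : E4)) (ε := δ)).compl).congr
      (Eventually.of_forall fun y => ?_)
    exact indicator_mul_left _ _ _
  have hsplit : radialPotential f r = radialPotential f₁ r + radialPotential f₂ r := by
    rw [radialPotential, radialPotential, radialPotential, ← integral_add i₁ i₂]
    congr 1
    funext y
    rw [← add_mul, hf₁, hf₂, indicator_self_add_compl_apply]
  have b₁ : |radialPotential f₁ r| ≤ ε * √(kernelEnergy β χ r).toReal := by
    refine (abs_radialPotential_le hβ h1 hχ hp m₁ hE₁ hr).trans ?_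
    gcongr
    rw [Real.sqrt_le_left hε.le]
    exact ENNReal.toReal_le_of_le_ofReal (by positivity) hδE.le
  have b₂ : |radialPotential f₂ r| ≤ ∫ y, ‖f y * (max δ ‖y‖ ^ 2)⁻¹‖ := by
    refine (abs_integral_le_integral_abs).trans ?_
    refine integral_mono i₂.abs i0 fun y => ?_
    by_cases hy : y ∈ Metric.ball (0 : E4) δ
    · simp only [hf₂, indicator, mem_compl_iff, hy, not_true_eq_false, if_false, zero_mul, abs_zero]
      positivity
    · have hyδ : δ ≤ ‖y‖ := by simpa using hy
      have : 0 < ‖y‖ := hδ.trans_le hyδ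
      simp only [hf₂, indicator, mem_compl_iff, hy, not_false_eq_true, if_true, Real.norm_eq_abs,
        abs_mul]
      rw [max_eq_right hyδ, abs_of_nonneg (max_pow_inv_nonneg r y),
        abs_of_nonneg (by positivity : 0 ≤ (‖y‖ ^ 2)⁻¹)]
      gcongr
      exact le_max_right _ _
  rw [hsplit]
  exact (abs_add_le _ _).trans (add_le_add b₁ b₂)

end Potential

/-! ### Inner product structure and weak convergence -/

section Space

variable {β : ℝ} {χ : ℝ → ℝ} {hχ : ContinuousOn χ (Ici 1)}

theorem isWeakLaplacian_weakLaplacian (u : X β χ hχ) : IsWeakLaplacian u.1 (weakLaplacian u.1) := by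
  obtain ⟨-, f, hf, -⟩ := u.2
  have h : ∃ f, IsWeakLaplacian u.1 f := ⟨f, hf⟩
  rw [weakLaplacian, dif_pos h]
  exact h.choose_spec

theorem integrable_weight_mul_sq (u : X β χ hχ) :
    Integrable fun x => weight β χ x * weakLaplacian u.1 x ^ 2 := by
  obtain ⟨-, f, hf, hi⟩ := u.2
  refine hi.congr ?_
  filter_upwards [hf.weakLaplacian_ae_eq] with x hx
  rw [hx]

theorem weakLaplacian_add (u v : X β χ hχ) :
    weakLaplacian (u + v).1 =ᵐ[volume] weakLaplacian u.1 + weakLaplacian v.1 :=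
  (((isWeakLaplacian_weakLaplacian u).add (isWeakLaplacian_weakLaplacian v)).congr
    (Lp.coeFn_add u.1 v.1).symm).weakLaplacian_ae_eq

theorem weakLaplacian_smul (c : ℝ) (u : X β χ hχ) :
    weakLaplacian (c • u).1 =ᵐ[volume] c • weakLaplacian u.1 :=
  (((isWeakLaplacian_weakLaplacian u).smul c).congr
    (Lp.coeFn_smul c u.1).symm).weakLaplacian_ae_eq

theorem betaNorm_nonneg (u : X β χ hχ) : 0 ≤ betaNorm u := Real.sqrt_nonneg _

theorem integrable_weight_mul_mul (u v : X β χ hχ) :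
    Integrable fun x => weight β χ x * (weakLaplacian u.1 x * weakLaplacian v.1 x) := by
  refine ((integrable_weight_mul_sq u).norm.add (integrable_weight_mul_sq v).norm).mono
    ((measurable_weight β hχ).aestronglyMeasurable.mul
      ((isWeakLaplacian_weakLaplacian u).right.aestronglyMeasurable.mul
        (isWeakLaplacian_weakLaplacian v).right.aestronglyMeasurable))
    (Eventually.of_forall fun x => ?_)
  simp only [Pi.add_apply, norm_mul, norm_pow]
  refine le_trans ?_ (le_abs_self _)
  nlinarith [norm_nonneg (weight β χ x),
    mul_nonneg (norm_nonneg (weight β χ x))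
      (sq_nonneg (‖weakLaplacian u.1 x‖ - ‖weakLaplacian v.1 x‖)),
    mul_nonneg (norm_nonneg (weight β χ x)) (mul_nonneg (norm_nonneg (weakLaplacian u.1 x))
      (norm_nonneg (weakLaplacian v.1 x)))]

/-- The inner product against `v` associated with `betaNorm`. -/
def betaInner (v : X β χ hχ) : X β χ hχ →ₗ[ℝ] ℝ where
  toFun u := ∫ x, weight β χ x * (weakLaplacian u.1 x * weakLaplacian v.1 x)
  map_add' u w := by
    rw [← integral_add (integrable_weight_mul_mul u v) (integrable_weight_mul_mul w v)]
    refine integral_congr_ae ?_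
    filter_upwards [weakLaplacian_add u w] with x hx
    rw [hx, Pi.add_apply]
    ring
  map_smul' c u := by
    rw [RingHom.id_apply, smul_eq_mul, ← integral_const_mul]
    refine integral_congr_ae ?_
    filter_upwards [weakLaplacian_smul c u] with x hx
    rw [hx, Pi.smul_apply, smul_eq_mul]
    ring

theorem betaInner_apply (u v : X β χ hχ) :
    betaInner v u = ∫ x, weight β χ x * (weakLaplacian u.1 x * weakLaplacian v.1 x) := rfl

theorem betaInner_comm (u v : X β χ hχ) : betaInner v u = betaInner u v := by
  simp only [betaInner_apply, mul_comm (weakLaplacian u.1 _)]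

theorem betaNorm_sq (hβ : 0 < β) (hpos : ∀ t, 1 ≤ t → 0 < χ t) (u : X β χ hχ) :
    betaNorm u ^ 2 = betaInner u u := by
  rw [betaNorm, Real.sq_sqrt (integral_nonneg fun x =>
    mul_nonneg (weight_nonneg hβ hpos x) (sq_nonneg _)), betaInner_apply]
  simp only [sq]

theorem betaNorm_sub_sq (hβ : 0 < β) (hpos : ∀ t, 1 ≤ t → 0 < χ t) (u v : X β χ hχ) :
    betaNorm (u - v) ^ 2 = betaNorm u ^ 2 - 2 * betaInner v u + betaNorm v ^ 2 := by
  rw [betaNorm_sq hβ hpos, betaNorm_sq hβ hpos, betaNorm_sq hβ hpos, map_sub,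
    betaInner_comm u (u - v), betaInner_comm v (u - v), map_sub, map_sub, betaInner_comm v u]
  ring

/-- The quadratic `t ↦ ‖u + t v‖_β²` is nonnegative, so its discriminant is not positive. -/
theorem abs_betaInner_le (hβ : 0 < β) (hpos : ∀ t, 1 ≤ t → 0 < χ t) (u v : X β χ hχ) :
    |betaInner v u| ≤ betaNorm v * betaNorm u := by
  have h : ∀ t : ℝ, 0 ≤ betaNorm v ^ 2 * (t * t) + (2 * betaInner v u) * t + betaNorm u ^ 2 := by
    intro t
    have := sq_nonneg (betaNorm (u + t • v))
    rw [betaNorm_sq hβ hpos, map_add, map_smul, betaInner_comm u (u + t • v),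
      betaInner_comm v (u + t • v), map_add, map_add, map_smul, map_smul, ← betaNorm_sq hβ hpos,
      ← betaNorm_sq hβ hpos, betaInner_comm v u] at this
    simp only [smul_eq_mul] at this
    linarith
  have hd := discrim_le_zero h
  rw [discrim] at hd
  refine abs_le_of_sq_le_sq ?_ (mul_nonneg (betaNorm_nonneg v) (betaNorm_nonneg u))
  nlinarith

theorem energy_weakLaplacian (hβ : 0 < β) (hpos : ∀ t, 1 ≤ t → 0 < χ t) (u : X β χ hχ) :
    energy β χ (weakLaplacian u.1) = ENNReal.ofReal (betaNorm u ^ 2) := by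
  have h0 : ∀ x, 0 ≤ weight β χ x * weakLaplacian u.1 x ^ 2 := fun x =>
    mul_nonneg (weight_nonneg hβ hpos x) (sq_nonneg _)
  rw [betaNorm, Real.sq_sqrt (integral_nonneg h0),
    ofReal_integral_eq_lintegral_ofReal (integrable_weight_mul_sq u) (Eventually.of_forall h0)]
  rfl

theorem ae_eq_radialPotential_weakLaplacian (hβ : 0 < β) (h1 : β < 1)
    (hp : ProfileAssumptions χ) (hD1 : ConditionD1 β χ) (hD2 : ConditionD2 β χ) (u : X β χ hχ) :
    ∀ᵐ x, 4 * Real.pi ^ 2 * u.1 x = -radialPotential (weakLaplacian u.1) ‖x‖ := by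
  obtain ⟨⟨g, -, hg⟩, -⟩ := u.2
  exact ae_eq_radialPotential (isWeakLaplacian_weakLaplacian u) hg (Lp.memLp u.1) hβ h1 hχ hp hD1
    hD2 (by rw [energy_weakLaplacian hβ hp.pos]; exact ENNReal.ofReal_lt_top)

theorem ae_abs_le (hβ : 0 < β) (h1 : β < 1)
    (hp : ProfileAssumptions χ) (hD1 : ConditionD1 β χ) (hD2 : ConditionD2 β χ) (u : X β χ hχ) :
    ∀ᵐ x, 4 * Real.pi ^ 2 * |u.1 x| ≤ betaNorm u * √(kernelEnergy β χ ‖x‖).toReal := by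
  have hne : ∀ᵐ x : E4, x ≠ 0 := by simp [ae_iff]
  have hE := energy_weakLaplacian hβ hp.pos u
  filter_upwards [ae_eq_radialPotential_weakLaplacian hβ h1 hp hD1 hD2 u, hne] with x hx hx0
  have h2 := abs_radialPotential_le hβ h1 hχ hp
    (isWeakLaplacian_weakLaplacian u).right.aestronglyMeasurable
    (hE ▸ ENNReal.ofReal_lt_top) (norm_pos_iff.2 hx0)
  rw [hE, ENNReal.toReal_ofReal (sq_nonneg _), Real.sqrt_sq (betaNorm_nonneg u), ← abs_neg, ← hx,
    abs_mul, abs_of_pos (by positivity : (0 : ℝ) < 4 * Real.pi ^ 2)] at h2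
  exact h2

theorem exists_ae_abs_le (hβ : 0 < β) (h1 : β < 1)
    (hp : ProfileAssumptions χ) (hD1 : ConditionD1 β χ) (hD2 : ConditionD2 β χ) (u : X β χ hχ)
    {ε : ℝ} (hε : 0 < ε) :
    ∃ C : ℝ, 0 ≤ C ∧
      ∀ᵐ x, 4 * Real.pi ^ 2 * |u.1 x| ≤ ε * √(kernelEnergy β χ ‖x‖).toReal + C := by
  have hne : ∀ᵐ x : E4, x ≠ 0 := by simp [ae_iff]
  have hE := energy_weakLaplacian hβ hp.pos u
  obtain ⟨C, hC, h⟩ := exists_abs_radialPotential_le hβ h1 hχ hp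
    (isWeakLaplacian_weakLaplacian u).right.aestronglyMeasurable (hE ▸ ENNReal.ofReal_lt_top) hε
  refine ⟨C, hC, ?_⟩
  filter_upwards [ae_eq_radialPotential_weakLaplacian hβ h1 hp hD1 hD2 u, hne] with x hx hx0
  have h2 := h _ (norm_pos_iff.2 hx0)
  rwa [← abs_neg, ← hx, abs_mul, abs_of_pos (by positivity : (0 : ℝ) < 4 * Real.pi ^ 2)] at h2

/-- By Cauchy–Schwarz `betaInner v` is an admissible functional, so its values along the sequence
tend to `‖v‖_β²`; it remains to expand the square. -/
theorem tendsto_betaNorm_sub (hβ : 0 < β) (hpos : ∀ t, 1 ≤ t → 0 < χ t) {u : ℕ → X β χ hχ}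
    {v : X β χ hχ} (hu : ∀ n, betaNorm (u n) = 1) (h : WeaklyConverges u v) :
    Tendsto (fun n => betaNorm (u n - v)) atTop (𝓝 √(1 - betaNorm v ^ 2)) := by
  have h1 := h (betaInner v) ⟨betaNorm v, fun w => abs_betaInner_le hβ hpos w v⟩
  rw [← betaNorm_sq hβ hpos] at h1
  have h2 : Tendsto (fun n => betaNorm (u n - v) ^ 2) atTop (𝓝 (1 - betaNorm v ^ 2)) := by
    have := (h1.const_mul 2).const_sub 1 |>.add_const (betaNorm v ^ 2)
    refine Tendsto.congr (fun n => ?_) (this.trans (le_of_eq ?_))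
    · rw [betaNorm_sub_sq hβ hpos, hu n]; ring
    · congr 1; ring
  refine h2.sqrt.congr fun n => ?_
  exact Real.sqrt_sq (betaNorm_nonneg _)

end Space

/-! ### Uniform exponential integrability -/

section

variable {β : ℝ} {χ : ℝ → ℝ}

theorem lintegral_ball_norm_rpow_lt_top {s : ℝ} (hs : -4 < s) :
    ∫⁻ x : E4, (Iio (1 : ℝ)).indicator (fun r => ENNReal.ofReal (r ^ s)) ‖x‖ < ⊤ := by
  rw [lintegral_radial (Measurable.indicator (by fun_prop) measurableSet_Iio)]
  refine ENNReal.mul_lt_top ENNReal.ofReal_lt_top ?_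
  have h : IntervalIntegrable (fun r : ℝ => r ^ (3 + s)) volume 0 1 :=
    intervalIntegral.intervalIntegrable_rpow' (by linarith)
  refine lt_of_le_of_lt ?_ h.1.lintegral_lt_top
  rw [← lintegral_indicator measurableSet_Ioi, ← lintegral_indicator measurableSet_Ioc]
  refine lintegral_mono fun r => ?_
  by_cases h0 : 0 < r
  · by_cases h1 : r < 1
    · have e : ENNReal.ofReal (r ^ 3) * ENNReal.ofReal (r ^ s) = ENNReal.ofReal (r ^ (3 + s)) := by
        rw [← ENNReal.ofReal_mul (by positivity), Real.rpow_add h0]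
        norm_cast
      simp [indicator, h0, h1, h1.le, e]
    · simp [indicator, h0, h1]
  · simp [indicator, h0]

theorem sqrt_add_le_add_sqrt {a b : ℝ} (ha : 0 ≤ a) (hb : 0 ≤ b) : √(a + b) ≤ √a + √b := by
  rw [Real.sqrt_le_left (by positivity), add_sq, Real.sq_sqrt ha, Real.sq_sqrt hb]
  have : 0 ≤ 2 * √a * √b := by positivity
  linarith

/-- Subadditivity of the square root isolates the leading term, whose power `2/(1-β)` is linear in
`1 - log r`. -/
theorem sqrt_kernelEnergy_le (hβ : 0 < β) (h1 : β < 1) (hχ : ContinuousOn χ (Ici 1))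
    (hp : ProfileAssumptions χ) :
    ∃ C : ℝ, 0 ≤ C ∧ ∀ r, 0 < r → r < 1 → √(kernelEnergy β χ r).toReal ≤
      √(2 * Real.pi ^ 2 / (1 - β)) * (1 - Real.log r) ^ ((1 - β) / 2) + C := by
  have hb : 0 < 1 - β := by linarith
  have hK := tailMass_one_lt_top hp
  refine ⟨√(2 * Real.pi ^ 2 * (1 + tailMass χ 1).toReal), Real.sqrt_nonneg _, fun r hr hr1 => ?_⟩
  have hL : 0 < 1 - Real.log r := by linarith [Real.log_neg hr hr1]
  have h := ENNReal.toReal_mono (by finiteness) (kernelEnergy_le_of_lt_one hβ h1 hχ hp hr hr1)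
  rw [ENNReal.toReal_mul, ENNReal.toReal_add (by finiteness) (by finiteness),
    ENNReal.toReal_ofReal (by positivity), ENNReal.toReal_ofReal (by positivity), mul_add] at h
  refine (Real.sqrt_le_sqrt h).trans ((sqrt_add_le_add_sqrt (by positivity)
    (by positivity)).trans (le_of_eq ?_))
  congr 1
  rw [show 2 * Real.pi ^ 2 * ((1 - Real.log r) ^ (1 - β) / (1 - β)) =
    2 * Real.pi ^ 2 / (1 - β) * (1 - Real.log r) ^ (1 - β) by ring, Real.sqrt_mul (by positivity),
    Real.sqrt_eq_rpow ((1 - Real.log r) ^ (1 - β)), ← Real.rpow_mul hL.le]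
  congr 2
  ring

/-- The sharpness of `alphaBeta`: the leading constant of the pointwise bound turns the exponent
into `4 (1 - log |x|)`, and `4` is the dimension. -/
theorem alphaBeta_mul (h1 : β < 1) :
    alphaBeta β * (√(2 * Real.pi ^ 2 / (1 - β)) / (4 * Real.pi ^ 2)) ^ (2 / (1 - β)) = 4 := by
  have hb : 0 < 1 - β := by linarith
  have hpi := Real.pi_pos
  have e : (√(2 * Real.pi ^ 2 / (1 - β)) / (4 * Real.pi ^ 2)) ^ (2 / (1 - β)) =
      (1 / (8 * Real.pi ^ 2 * (1 - β))) ^ (1 / (1 - β)) := by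
    rw [show 2 / (1 - β) = (2 : ℝ) * (1 / (1 - β)) by ring, Real.rpow_mul (by positivity),
      Real.rpow_two, div_pow, Real.sq_sqrt (by positivity)]
    congr 1
    field_simp
    ring
  rw [e, alphaBeta, mul_assoc, ← Real.mul_rpow (by positivity) (by positivity),
    mul_one_div_cancel (by positivity), Real.one_rpow, mul_one]

/-- A subcritical linear majorant absorbs additive constants under a power. -/
theorem exists_rpow_add_le {q a b C : ℝ} (hq : 0 ≤ q) (ha : 0 ≤ a) (hab : a < b) (hC : 0 ≤ C) :
    ∃ D : ℝ, 0 ≤ D ∧ ∀ y, 0 ≤ y → (a * y + C) ^ q ≤ b ^ q * y ^ q + D := by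
  have hb : 0 ≤ b := ha.trans hab.le
  have hy0 : 0 ≤ C / (b - a) := div_nonneg hC (by linarith)
  refine ⟨(a * (C / (b - a)) + C) ^ q, by positivity, fun y hy => ?_⟩
  rcases le_total y (C / (b - a)) with h | h
  · have : (a * y + C) ^ q ≤ (a * (C / (b - a)) + C) ^ q := by gcongr
    have : 0 ≤ b ^ q * y ^ q := by positivity
    linarith
  · have h2 : a * y + C ≤ b * y := by
      rw [div_le_iff₀ (by linarith)] at h
      linarith
    have h3 : (a * y + C) ^ q ≤ (b * y) ^ q := Real.rpow_le_rpow (by positivity) h2 hq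
    rw [Real.mul_rpow hb hy] at h3
    have : 0 ≤ (a * (C / (b - a)) + C) ^ q := by positivity
    linarith

theorem exists_gt_mul_rpow_lt_one {p η q : ℝ} (hq : 0 ≤ q) (h : p * η ^ q < 1) :
    ∃ b, η < b ∧ p * b ^ q < 1 := by
  have hc : ContinuousAt (fun b : ℝ => p * b ^ q) η :=
    continuousAt_const.mul (Real.continuousAt_rpow_const _ _ (Or.inr hq))
  have hev : ∀ᶠ b in 𝓝[>] η, p * b ^ q < 1 :=
    nhdsWithin_le_nhds (hc.eventually (gt_mem_nhds h))
  obtain ⟨b, hb, hb'⟩ := (hev.and self_mem_nhdsWithin).exists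
  exact ⟨b, hb', hb⟩

/-- Uniform exponential integrability below the critical growth. -/
theorem exists_lintegral_exp_le (hβ : 0 < β) (h1 : β < 1) (hχ : ContinuousOn χ (Ici 1))
    (hp : ProfileAssumptions χ) (hD1 : ConditionD1 β χ) (hD2 : ConditionD2 β χ)
    {p η C : ℝ} (hp0 : 0 < p) (hη : 0 ≤ η) (hpη : p * η ^ (2 / (1 - β)) < 1) (hC : 0 ≤ C) :
    ∃ B : ℝ≥0∞, B < ⊤ ∧ ∀ w : E4 → ℝ,
      (∀ᵐ x, 4 * Real.pi ^ 2 * |w x| ≤ η * √(kernelEnergy β χ ‖x‖).toReal + C) →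
      (∀ᵐ x, 4 * Real.pi ^ 2 * |w x| ≤ √(kernelEnergy β χ ‖x‖).toReal) →
      ∫⁻ x, ENNReal.ofReal (Real.exp (p * alphaBeta β * |w x| ^ (2 / (1 - β))) - 1) ≤ B := by
  have hb : 0 < 1 - β := by linarith
  have hpi := Real.pi_pos
  set q := 2 / (1 - β) with hq
  have hq0 : 0 < q := by positivity
  have hα : 0 < alphaBeta β := by unfold alphaBeta; positivity
  set κ := √(2 * Real.pi ^ 2 / (1 - β)) / (4 * Real.pi ^ 2) with hκ
  have hκ0 : 0 < κ := by positivity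
  have hακ : alphaBeta β * κ ^ q = 4 := alphaBeta_mul h1
  obtain ⟨C₁, hC₁, hS⟩ := sqrt_kernelEnergy_le hβ h1 hχ hp
  -- The slack between `η` and `b` pays for the additive constants, leaving the singularity
  -- `|x|^(-4θ)` with `θ < 1`.
  obtain ⟨b, hηb, hpb⟩ := exists_gt_mul_rpow_lt_one hq0.le hpη
  set θ := p * b ^ q with hθ
  have hb0 : 0 ≤ b := hη.trans hηb.le
  have hθ0 : 0 ≤ θ := by positivity
  obtain ⟨D, hD, hDle⟩ := exists_rpow_add_le (q := q) (a := η * κ) (b := b * κ)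
    (C := (η * C₁ + C) / (4 * Real.pi ^ 2)) hq0.le (by positivity) (by gcongr) (by positivity)
  set G₁ : E4 → ℝ≥0∞ := fun x => ENNReal.ofReal (Real.exp (p * alphaBeta β * D + 4 * θ)) *
    (Iio (1 : ℝ)).indicator (fun r => ENNReal.ofReal (r ^ (-(4 * θ)))) ‖x‖ with hG₁
  set c := p * alphaBeta β * (1 / (4 * Real.pi ^ 2)) ^ q with hc
  have hc0 : 0 < c := by positivity
  -- Since `kernelEnergy` decreases, the exponent is bounded outside the unit ball by its value at
  -- radius `1`; `T` collects the resulting constants.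
  set T := Real.exp (c * (kernelEnergy β χ 1).toReal ^ (1 / (1 - β))) * c with hT
  have hT0 : 0 < T := by positivity
  have hmeas : MeasurableSet {x : E4 | 1 < ‖x‖} := measurableSet_lt measurable_const measurable_norm
  set G₂ : E4 → ℝ≥0∞ := {x : E4 | 1 < ‖x‖}.indicator
    (fun x => ENNReal.ofReal T * kernelEnergy β χ ‖x‖ ^ (1 / (1 - β))) with hG₂
  have hmG₁ : Measurable G₁ := by
    refine Measurable.const_mul (Measurable.comp (g := (Iio (1 : ℝ)).indicator _) ?_ measurable_norm) _
    exact Measurable.indicator (by fun_prop) measurableSet_Iio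
  refine ⟨∫⁻ x, (G₁ x + G₂ x), ?_, fun w hw1 hw2 => ?_⟩
  · rw [lintegral_add_left hmG₁]
    refine ENNReal.add_lt_top.2 ⟨?_, ?_⟩
    · rw [hG₁, lintegral_const_mul' _ _ ENNReal.ofReal_ne_top]
      exact ENNReal.mul_lt_top ENNReal.ofReal_lt_top (lintegral_ball_norm_rpow_lt_top (by linarith))
    · rw [hG₂, lintegral_indicator hmeas, lintegral_const_mul' _ _ ENNReal.ofReal_ne_top]
      exact ENNReal.mul_lt_top ENNReal.ofReal_lt_top
        (lintegral_kernelEnergy_rpow_lt_top hβ h1 hχ hp hD1 hD2)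
  have hr : ∀ᵐ r : ℝ, 0 < r → r ≠ 1 := by
    filter_upwards [(measure_eq_zero_iff_ae_notMem.1 (Real.volume_singleton (a := 1)))] with r h _
    simpa using h
  have hne : ∀ᵐ x : E4, x ≠ 0 := by simp [ae_iff]
  refine lintegral_mono_ae ?_
  filter_upwards [hw1, hw2, hne, ae_norm_of_ae hr] with x h1x h2x hx0 hx1
  have hr0 : 0 < ‖x‖ := norm_pos_iff.2 hx0
  rcases lt_or_gt_of_ne hx1 with hlt | hgt
  · refine le_trans ?_ le_self_add
    have hL : 0 < 1 - Real.log ‖x‖ := by linarith [Real.log_neg hr0 hlt]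
    set y := (1 - Real.log ‖x‖) ^ ((1 - β) / 2) with hy
    have hy0 : 0 ≤ y := by positivity
    have hyq : y ^ q = 1 - Real.log ‖x‖ := by
      rw [hy, ← Real.rpow_mul hL.le, hq, show (1 - β) / 2 * (2 / (1 - β)) = 1 by field_simp,
        Real.rpow_one]
    have hw : |w x| ≤ η * κ * y + (η * C₁ + C) / (4 * Real.pi ^ 2) := by
      rw [show η * κ * y + (η * C₁ + C) / (4 * Real.pi ^ 2) =
        (η * (√(2 * Real.pi ^ 2 / (1 - β)) * y + C₁) + C) / (4 * Real.pi ^ 2) by rw [hκ]; ring,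
        le_div_iff₀ (by positivity), mul_comm]
      refine h1x.trans ?_
      gcongr
      exact hS _ hr0 hlt
    have hpow : p * alphaBeta β * |w x| ^ q ≤ 4 * θ * (1 - Real.log ‖x‖) + p * alphaBeta β * D := by
      calc p * alphaBeta β * |w x| ^ q
          ≤ p * alphaBeta β * ((b * κ) ^ q * y ^ q + D) := by
            gcongr
            exact (Real.rpow_le_rpow (abs_nonneg _) hw hq0.le).trans (hDle y hy0)
        _ = (alphaBeta β * κ ^ q) * (p * b ^ q) * y ^ q + p * alphaBeta β * D := by
            rw [Real.mul_rpow hb0 hκ0.le]; ring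
        _ = _ := by rw [hακ, hyq]
    have e : G₁ x = ENNReal.ofReal (Real.exp (p * alphaBeta β * D + 4 * θ) *
        ‖x‖ ^ (-(4 * θ))) := by
      simp [hG₁, indicator, hlt, ENNReal.ofReal_mul (Real.exp_pos _).le]
    rw [e]
    refine ENNReal.ofReal_le_ofReal ?_
    rw [Real.rpow_def_of_pos hr0, ← Real.exp_add]
    have : Real.exp (p * alphaBeta β * |w x| ^ q) ≤
        Real.exp (p * alphaBeta β * D + 4 * θ + Real.log ‖x‖ * -(4 * θ)) := by
      refine Real.exp_le_exp.2 (hpow.trans (le_of_eq ?_))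
      ring
    linarith
  · refine le_trans ?_ le_add_self
    have hSt := kernelEnergy_lt_top hβ h1 hχ hp hr0
    have hS1 := kernelEnergy_lt_top hβ h1 hχ hp one_pos
    set S := (kernelEnergy β χ ‖x‖).toReal with hSdef
    have hSle : S ≤ (kernelEnergy β χ 1).toReal :=
      ENNReal.toReal_mono hS1.ne (kernelEnergy_antitone hβ hp one_pos hgt.le)
    have hS0 : 0 ≤ S := ENNReal.toReal_nonneg
    -- Here the bound without additive constant is essential, because a constant would not be
    -- integrable at infinity.
    have hz : p * alphaBeta β * |w x| ^ q ≤ c * S ^ (1 / (1 - β)) := by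
      have h3 : |w x| ≤ 1 / (4 * Real.pi ^ 2) * √S := by
        rw [one_div_mul_eq_div, le_div_iff₀ (by positivity), mul_comm]
        exact h2x
      calc p * alphaBeta β * |w x| ^ q ≤ p * alphaBeta β * (1 / (4 * Real.pi ^ 2) * √S) ^ q := by
            gcongr
        _ = c * S ^ (1 / (1 - β)) := by
            rw [Real.mul_rpow (by positivity) (by positivity), Real.sqrt_eq_rpow,
              ← Real.rpow_mul hS0, hc, hq, ← mul_assoc]
            congr 2
            ring
    have e : G₂ x = ENNReal.ofReal (T * S ^ (1 / (1 - β))) := by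
      rw [hG₂, indicator_of_mem (show x ∈ {x : E4 | 1 < ‖x‖} from hgt),
        ENNReal.ofReal_mul hT0.le, ← ENNReal.ofReal_rpow_of_nonneg hS0 (by positivity), hSdef,
        ENNReal.ofReal_toReal hSt.ne]
    rw [e]
    refine ENNReal.ofReal_le_ofReal ?_
    set Z := c * S ^ (1 / (1 - β)) with hZ
    have hZ0 : 0 ≤ Z := by positivity
    have h4 : Real.exp (p * alphaBeta β * |w x| ^ q) ≤ Real.exp Z := Real.exp_le_exp.2 hz
    -- This follows from `1 - Z ≤ exp(-Z)`, and makes the integrand linear in `S^(1/(1-β))` up to a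
    -- bounded factor.
    have h5 : Real.exp Z - 1 ≤ Real.exp Z * Z := by
      have := Real.one_sub_le_exp_neg Z
      have h6 : Real.exp Z * (1 - Z) ≤ Real.exp Z * Real.exp (-Z) := by gcongr
      rw [← Real.exp_add, add_neg_cancel, Real.exp_zero] at h6
      linarith
    have h7 : Real.exp Z ≤ Real.exp (c * (kernelEnergy β χ 1).toReal ^ (1 / (1 - β))) := by
      rw [hZ]
      gcongr
    calc Real.exp (p * alphaBeta β * |w x| ^ q) - 1 ≤ Real.exp Z * Z := by linarith
      _ ≤ Real.exp (c * (kernelEnergy β χ 1).toReal ^ (1 / (1 - β))) * Z := by gcongr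
      _ = T * S ^ (1 / (1 - β)) := by rw [hT, hZ]; ring

/-! ### The threshold and the conclusion -/

theorem mul_rpow_lt_one_of_lt_threshold {hχ : ContinuousOn χ (Ici 1)} (h1 : β < 1) {v : X β χ hχ}
    {p : ℝ} (hp : ENNReal.ofReal p < threshold v) :
    p * √(1 - betaNorm v ^ 2) ^ (2 / (1 - β)) < 1 := by
  have hb : 0 < 1 - β := by linarith
  by_cases h : betaNorm v < 1
  · have hpos : 0 < 1 - betaNorm v ^ 2 := by
      have := betaNorm_nonneg v
      nlinarith
    rw [threshold, if_pos h, ENNReal.ofReal_lt_ofReal_iff (by positivity),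
      lt_div_iff₀ (by positivity)] at hp
    rwa [Real.sqrt_eq_rpow, ← Real.rpow_mul hpos.le,
      show (1 : ℝ) / 2 * (2 / (1 - β)) = 1 / (1 - β) by ring]
  -- When the norm is at least one the square root is `0`, which makes every `p` admissible.
  · rw [Real.sqrt_eq_zero_of_nonpos (by nlinarith [not_lt.1 h]), Real.zero_rpow (by positivity)]
    norm_num

theorem iSup_lintegral_exp_lt_top {hχ : ContinuousOn χ (Ici 1)} (hβ₀ : 0 < β) (hβ₁ : β < 1)
    (hprofile : ProfileAssumptions χ) (hD1 : ConditionD1 β χ) (hD2 : ConditionD2 β χ)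
    {u : ℕ → X β χ hχ} {u₀ : X β χ hχ} (hnorm : ∀ n, betaNorm (u n) = 1)
    (hweak : WeaklyConverges u u₀) {p : ℝ} (hp₀ : 0 < p) (hp : ENNReal.ofReal p < threshold u₀) :
    (⨆ n, ∫⁻ x : E4, ENNReal.ofReal
      (Real.exp (p * alphaBeta β * |(u n).1 x| ^ (2 / (1 - β))) - 1)) < ⊤ := by
  have hq : 0 < 2 / (1 - β) := div_pos two_pos (by linarith)
  obtain ⟨η, hη, hpη⟩ := exists_gt_mul_rpow_lt_one hq.le (mul_rpow_lt_one_of_lt_threshold hβ₁ hp)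
  set η₀ := √(1 - betaNorm u₀ ^ 2)
  have hη₀ : 0 ≤ η₀ := Real.sqrt_nonneg _
  -- The gap `η - η₀` is shared equally: one `δ` for the convergence of `‖u_n - u₀‖_β`, one for the
  -- bound on `u₀`.
  set δ := (η - η₀) / 2 with hδ
  have hδ0 : 0 < δ := by linarith
  have hδη : δ ≤ η := by linarith
  have hpδ : p * δ ^ (2 / (1 - β)) < 1 := lt_of_le_of_lt (by gcongr) hpη
  have hext : ∀ n, ∀ᵐ x, 4 * Real.pi ^ 2 * |(u n).1 x| ≤ √(kernelEnergy β χ ‖x‖).toReal := fun n => by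
    simpa [hnorm n] using ae_abs_le hβ₀ hβ₁ hprofile hD1 hD2 (u n)
  -- Each single integral is finite because a fixed function is negligible at the critical scale.
  -- This covers the finitely many indices before the limit takes effect.
  have hsingle : ∀ n, ∫⁻ x : E4, ENNReal.ofReal
      (Real.exp (p * alphaBeta β * |(u n).1 x| ^ (2 / (1 - β))) - 1) < ⊤ := by
    intro n
    obtain ⟨C, hC, h⟩ := exists_ae_abs_le hβ₀ hβ₁ hprofile hD1 hD2 (u n) hδ0
    obtain ⟨B, hB, hBle⟩ := exists_lintegral_exp_le hβ₀ hβ₁ hχ hprofile hD1 hD2 hp₀ hδ0.le hpδ hC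
    exact (hBle _ h (hext n)).trans_lt hB
  obtain ⟨C, hC, h⟩ := exists_ae_abs_le hβ₀ hβ₁ hprofile hD1 hD2 u₀ hδ0
  obtain ⟨B, hB, hBle⟩ := exists_lintegral_exp_le hβ₀ hβ₁ hχ hprofile hD1 hD2 hp₀
    (hδ0.le.trans hδη) hpη hC
  have hev : ∀ᶠ n in Filter.atTop, betaNorm (u n - u₀) < η₀ + δ :=
    (tendsto_betaNorm_sub hβ₀ hprofile.pos hnorm hweak).eventually (gt_mem_nhds (by linarith))
  obtain ⟨N, hN⟩ := Filter.eventually_atTop.1 hev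
  have hbound : ∀ n, ∫⁻ x : E4, ENNReal.ofReal
      (Real.exp (p * alphaBeta β * |(u n).1 x| ^ (2 / (1 - β))) - 1) ≤
      B + ∑ m ∈ Finset.range N, ∫⁻ x : E4, ENNReal.ofReal
        (Real.exp (p * alphaBeta β * |(u m).1 x| ^ (2 / (1 - β))) - 1) := by
    intro n
    rcases lt_or_ge n N with hn | hn
    · exact le_add_left (Finset.single_le_sum (f := fun m => ∫⁻ x : E4, ENNReal.ofReal
        (Real.exp (p * alphaBeta β * |(u m).1 x| ^ (2 / (1 - β))) - 1))
        (fun _ _ => zero_le) (Finset.mem_range.2 hn))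
    · refine le_add_right (hBle _ ?_ (hext n))
      filter_upwards [ae_abs_le hβ₀ hβ₁ hprofile hD1 hD2 (u n - u₀), h,
        MeasureTheory.Lp.coeFn_sub (u n).1 u₀.1] with x h1 h2 h3
      have e : (u n).1 x = (u n - u₀).1 x + u₀.1 x := by
        have : (u n - u₀).1 x = (u n).1 x - u₀.1 x := h3
        linarith
      have h4 : |(u n).1 x| ≤ |(u n - u₀).1 x| + |u₀.1 x| := by
        rw [e]; exact abs_add_le _ _
      have h5 : betaNorm (u n - u₀) * √(kernelEnergy β χ ‖x‖).toReal ≤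
          (η₀ + δ) * √(kernelEnergy β χ ‖x‖).toReal := by
        have := (hN n hn).le
        gcongr
      have h6 : η = (η₀ + δ) + δ := by rw [hδ]; ring
      calc 4 * Real.pi ^ 2 * |(u n).1 x|
          ≤ 4 * Real.pi ^ 2 * (|(u n - u₀).1 x| + |u₀.1 x|) := by gcongr
        _ ≤ η * √(kernelEnergy β χ ‖x‖).toReal + C := by
          rw [mul_add, h6, add_mul (η₀ + δ)]
          linarith
  refine (iSup_le hbound).trans_lt (ENNReal.add_lt_top.2 ⟨hB, ?_⟩)
  exact ENNReal.sum_lt_top.2 fun m _ => hsingle m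

end

end WeightedAdams

end


theorem theorem1p2 (β : ℝ) (hβ₀ : 0 < β) (hβ₁ : β < 1)
    (χ : ℝ → ℝ) (hχ : ContinuousOn χ (Set.Ici 1))
    (hprofile : WeightedAdams.ProfileAssumptions χ)
    (hD1 : WeightedAdams.ConditionD1 β χ) (hD2 : WeightedAdams.ConditionD2 β χ)
    (u : ℕ → WeightedAdams.X β χ hχ) (u₀ : WeightedAdams.X β χ hχ) (hu₀ : u₀ ≠ 0)
    (hnorm : ∀ n, WeightedAdams.betaNorm (u n) = 1)
    (hweak : WeightedAdams.WeaklyConverges u u₀)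
    (p : ℝ) (hp₀ : 0 < p) (hp : ENNReal.ofReal p < WeightedAdams.threshold u₀) :
    (⨆ n, ∫⁻ x : WeightedAdams.E4, ENNReal.ofReal
      (Real.exp (p * WeightedAdams.alphaBeta β * |(u n).1 x| ^ (2 / (1 - β))) - 1)) < ⊤ := by
  exact WeightedAdams.iSup_lintegral_exp_lt_top hβ₀ hβ₁ hprofile hD1 hD2 hnorm hweak hp₀ hp
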